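/- **Setting.** Write points of $\mathbb R^{n+2}=\mathbb R^{n+1}\times\mathbb R$ as $(\hat x,x^{n+2})$. Let $P\subset\mathbb R^{n+1}$ be open, let $\psi\colon P\to\mathbb R$ be smooth, proper and bounded above, and let $\mathcal O=\{(\hat x,x^{n+2}):\hat x\in P,\ x^{n+2}<\psi(\hat x)\}$. Let $d$ be the signed Euclidean distance to $\partial\mathcal O$, negative in $\mathcal O$. Let $\beta\in C^\infty(\mathbb R,[0,\infty))$ be supported in $(-\infty,0]$, not identically zero, with $\beta''$ non-increasing. For $\varepsilon>0$ put $\alpha_\varepsilon=\beta(d/\varepsilon)$. At points where $\nu_{\mathcal O}=\bar\nabla d$ exists and points upward, put $v_{\mathcal O}=\langle\nu_{\mathcal O},e_{n+2}\rangle^{-1}$. A *graphical solution of the penalised flow* $\frac{d}{dt}F=-(H-\alpha_\varepsilon)\nu$ is a pair $(\Omega,u)$, where $\Omega\subset\mathbb R^{n+1}\times[0,\infty)$ is relatively open with time slices $\Omega_t$, $u$ is smooth on $\Omega$ (up to $t=0$), and $$\dot u=\sqrt{1+|Du|^2}\,\Big(\operatorname{div}\tfrac{Du}{\sqrt{1+|Du|^2}}+\alpha_\varepsilon(x,u(x,t))\Big)\quad\text{in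 }\Omega .$$ We write $M_t=\operatorname{graph}u(\cdot,t)|_{\Omega_t}$, $\nu$ for its upward unit normal, $U$ for the height $x^{n+2}$ on $M_t$, and $v=\langle\nu,e_{n+2}\rangle^{-1}$. For $L\in\mathbb R$ we call the solution *truncated at level $L$* if * $\{x\in P:\psi(x)\ge L\}\subset\Omega_t$ for all $t\ge0$; * $M_0$ is disjoint from $\mathcal O$ and contained in $\{x^{n+2}\ge L\}$; * the values of $u$ at the lateral boundary of $\Omega$ and at spatial infinity are at least $L$, that is, $\{(x,t)\in\Omega:t\le T,\ u(x,t)\le c\}$ is compact for all $T$ and all $c<L$. (For example, this holds for solutions over a ball $B$ with $u=L$ on $\partial B$, $u(\cdot,0)\ge\max\{\psi,L\}$, and $\psi<L$ outside $B$.) For $\ell\in\mathbb R$ we say that the solution is *compact above $\ell$* if for some $a>0$ the space-time track $\{(p,t):t\ge0,\ p\in M_t,\ p^{n+2}\ge\ell-a\}$ is closed (the surfaces have no boundary, and no piece appears or vanishes abruptly, in this half space) and each $M_t\cap\{x^{n+2}\ge\ell-a\}$, $t\ge 0$, is compact. We say that $K\in\mathbb R$ is an *obstacle bound at level $\ell$*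 for the solution if for all $t\ge0$ and all $p\in M_t\cap\mathcal O\cap\{x^{n+2}\ge\ell\}$ the function $d$ is differentiable at $p$, $\langle\nu_{\mathcal O}(p),e_{n+2}\rangle>0$, and $\alpha_\varepsilon(p)+v_{\mathcal O}(p)\le K$. **Proposition.** There is a function $C\colon\mathbb R^2\to\mathbb R$ with the following property. For all $n$, $P$, $\psi$ and $\beta$ as above there are numbers $\varepsilon_0(L)>0$ ($L\in\mathbb R$) and $K_0(\ell)$ ($\ell\in\mathbb R$), such that for all $L,\ell\in\mathbb R$, all $0<\varepsilon<\varepsilon_0(L)$ and every graphical solution of the penalised flow which is truncated at level $L$ and compact above $\ell$: 1. $K_0(\ell)$ is an obstacle bound at level $\ell$ for the solution (it is independent of $\varepsilon$, $L$ and the solution); 2. for every obstacle bound $K$ at level $\ell$ for the solution (in particular for $K=K_0(\ell)$), $$(U-\ell)^2\,v\ \le\ \sup_{M_0\cap\{x^{n+2}\ge\ell\}}(U-\ell)^2\,v\;+\;C\big(\sup_{M_0}U-\ell,\;K\big)$$ for all times $t\ge0$ and at all points of $M_t$ with height $U\ge\ell$. (If there are no points of $M_t$ with height $U\ge\ell$,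 nothing is claimed about $M_t$; a supremum over the empty set is read as $0$.) -/

import Mathlib

open scoped ContDiff

/-- The horizontal space `ℝ^{n+1}`. -/
abbrev Base (n : ℕ) : Type := EuclideanSpace ℝ (Fin (n + 1))

/-- The ambient Euclidean space `ℝ^{n+2} = ℝ^{n+1} × ℝ` (with the `ℓ²` product norm); the second
component of a point is its height `x^{n+2}`. -/
abbrev Ambient (n : ℕ) : Type := WithLp 2 (Base n × ℝ)

noncomputable section

/-- The point of `ℝ^{n+2}` above `x` at height `y`. -/
def point {n : ℕ} (x : Base n) (y : ℝ) : Ambient n := WithLp.toLp 2 (x, y)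

/-- The vertical unit vector `e_{n+2}`. -/
def vertical (n : ℕ) : Ambient n := point 0 1

/-! ### Obstacle and penalisation -/

/-- `ψ : P → ℝ` describes a smooth obstacle: `P` is open, and `ψ` is smooth, proper and bounded
above on `P`. -/
structure IsObstacle {n : ℕ} (P : Set (Base n)) (ψ : Base n → ℝ) : Prop where
  isOpen : IsOpen P
  smooth : ContDiffOn ℝ ∞ ψ P
  proper : IsProperMap (P.domRestrict ψ)
  bddAbove : BddAbove (ψ '' P)

/-- The obstacle `𝒪 = {(x, y) : x ∈ P, y < ψ x}`. -/
def obstacle {n : ℕ} (P : Set (Base n)) (ψ : Base n → ℝ) : Set (Ambient n) :=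
  {p | p.fst ∈ P ∧ p.snd < ψ p.fst}

open Classical in
/-- The signed Euclidean distance to the boundary of `A`, negative in `A`. -/
def signedDistBdry {n : ℕ} (A : Set (Ambient n)) (p : Ambient n) : ℝ :=
  if p ∈ A then -Metric.infDist p (frontier A) else Metric.infDist p (frontier A)

/-- The admissible penalty profiles `β`: smooth, nonnegative, supported in `(-∞, 0]`, with
non-increasing second derivative, and not identically zero. -/
structure IsPenaltyProfile (β : ℝ → ℝ) : Prop where
  smooth : ContDiff ℝ ∞ β
  nonneg : ∀ s, 0 ≤ β s
  support : tsupport β ⊆ Set.Iic 0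
  antitone : Antitone (deriv (deriv β))
  nontrivial : ∃ s, β s ≠ 0

/-- The penalisation `α_ε(p) = β(dist(p) / ε)`, `dist` the signed distance to `∂A`. -/
def penalisation {n : ℕ} (β : ℝ → ℝ) (ε : ℝ) (A : Set (Ambient n)) (p : Ambient n) : ℝ :=
  β (signedDistBdry A p / ε)

/-! ### Geometry of graphs -/

/-- The upward unit normal `(-Df, 1) / √(1 + |Df|²)` of the graph of `f` at the point above `x`. -/
def graphNormal {n : ℕ} (f : Base n → ℝ) (x : Base n) : Ambient n :=
  (Real.sqrt (1 + ‖gradient f x‖ ^ 2))⁻¹ • point (-gradient f x) 1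

/-- The gradient function `v = ⟨ν, e_{n+2}⟩⁻¹` of the graph of `f` at the point above `x`. -/
def gradientFunction {n : ℕ} (f : Base n → ℝ) (x : Base n) : ℝ :=
  (inner ℝ (graphNormal f x) (vertical n))⁻¹

/-- The divergence of a vector field on `ℝ^{n+1}`. -/
def divergence {n : ℕ} (X : Base n → Base n) (x : Base n) : ℝ :=
  ∑ i, fderiv ℝ X x (EuclideanSpace.single i 1) i

/-- The mean curvature `H = -div (Df / √(1 + |Df|²))` of the graph of `f` with respect to the
upward normal; with this sign, concave graphs have `H ≥ 0` and `ΔF = -H ν`. -/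
def meanCurvature {n : ℕ} (f : Base n → ℝ) (x : Base n) : ℝ :=
  -divergence (fun y => (Real.sqrt (1 + ‖gradient f y‖ ^ 2))⁻¹ • gradient f y) x

/-! ### The penalised flow -/

/-- The evolving surface `M_t = graph u(·, t)` over the time slice of `Ω ⊆ ℝ^{n+1} × [0, ∞)`. -/
def surface {n : ℕ} (Ω : Set (Base n × ℝ)) (u : Base n → ℝ → ℝ) (t : ℝ) : Set (Ambient n) :=
  {p | (p.fst, t) ∈ Ω ∧ p.snd = u p.fst t}

/-- `(Ω, u)` is a smooth graphical solution of the penalised flow `dF/dt = -(H - α_ε) ν`, for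
times in `[0, ∞)`: `Ω` is relatively open in `ℝ^{n+1} × [0, ∞)`, `u` is smooth on `Ω` up to `t = 0`,
and the graphs move with normal velocity `-(H - α_ε)`, that is,
`∂u/∂t = √(1 + |Du|²) (div (Du / √(1 + |Du|²)) + α_ε)`. -/
structure IsPenalisedFlow {n : ℕ} (P : Set (Base n)) (ψ : Base n → ℝ) (β : ℝ → ℝ) (ε : ℝ)
    (Ω : Set (Base n × ℝ)) (u : Base n → ℝ → ℝ) : Prop where
  domain : ∃ G : Set (Base n × ℝ), IsOpen G ∧ Ω = G ∩ {z | 0 ≤ z.2}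
  smooth : ContDiffOn ℝ ∞ (fun z : Base n × ℝ => u z.1 z.2) Ω
  evolution : ∀ x t, (x, t) ∈ Ω →
    derivWithin (fun s => u x s) (Set.Ici 0) t =
      -Real.sqrt (1 + ‖gradient (fun y => u y t) x‖ ^ 2) *
        (meanCurvature (fun y => u y t) x -
          penalisation β ε (obstacle P ψ) (point x (u x t)))

/-- The flow respects the truncation level `L`: the graphs are defined over the part `{ψ ≥ L}` of
the obstacle for all times, `M_0` is disjoint from the obstacle and contained in `{x^{n+2} ≥ L}`,
and the boundary values of `u` on the lateral boundary of `Ω` and at spatial infinity are at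
least `L` (a sequence in `Ω` with bounded times along which `u ≤ c < L` accumulates in `Ω`).
The solutions over a ball `B`, with `u = L` on `∂B` and `ψ < L` outside `B`, are of this kind. -/
structure IsTruncatedAt {n : ℕ} (P : Set (Base n)) (ψ : Base n → ℝ) (L : ℝ)
    (Ω : Set (Base n × ℝ)) (u : Base n → ℝ → ℝ) : Prop where
  covers : ∀ x ∈ P, L ≤ ψ x → ∀ t, 0 ≤ t → (x, t) ∈ Ω
  disjoint : Disjoint (surface Ω u 0) (obstacle P ψ)
  initial : ∀ p ∈ surface Ω u 0, L ≤ p.snd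
  boundary : ∀ T c : ℝ, c < L → IsCompact {z ∈ Ω | z.2 ≤ T ∧ u z.1 z.2 ≤ c}

/-- For some `a > 0`, the flow has no boundary in `{x^{n+2} ≥ ℓ - a}` and no piece of it appears or
vanishes abruptly there (its space-time track in that half space is closed), and each
`M_t ∩ {x^{n+2} ≥ ℓ - a}` is compact. -/
def IsCompactAbove {n : ℕ} (ℓ : ℝ) (Ω : Set (Base n × ℝ)) (u : Base n → ℝ → ℝ) : Prop :=
  ∃ a : ℝ, 0 < a ∧
    IsClosed {z : Ambient n × ℝ | 0 ≤ z.2 ∧ z.1 ∈ surface Ω u z.2 ∧ ℓ - a ≤ z.1.snd} ∧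
    ∀ t, 0 ≤ t → IsCompact {p ∈ surface Ω u t | ℓ - a ≤ p.snd}

/-- `K` bounds the penalisation and the gradient function of the obstacle along the flow: at every
point `p ∈ M_t ∩ 𝒪 ∩ {x^{n+2} ≥ ℓ}`, `t ≥ 0`, the unit normal `ν_𝒪 = ∇ dist` to the level set of the
signed distance through `p` exists and points upward, and `α_ε(p) + v_𝒪(p) ≤ K`, where
`v_𝒪 = ⟨ν_𝒪, e_{n+2}⟩⁻¹`. -/
def IsObstacleBound {n : ℕ} (P : Set (Base n)) (ψ : Base n → ℝ) (β : ℝ → ℝ) (ε ℓ : ℝ)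
    (Ω : Set (Base n × ℝ)) (u : Base n → ℝ → ℝ) (K : ℝ) : Prop :=
  ∀ t, 0 ≤ t → ∀ p ∈ surface Ω u t ∩ obstacle P ψ, ℓ ≤ p.snd →
    DifferentiableAt ℝ (signedDistBdry (obstacle P ψ)) p ∧
    0 < inner ℝ (gradient (signedDistBdry (obstacle P ψ)) p) (vertical n) ∧
    penalisation β ε (obstacle P ψ) p +
      (inner ℝ (gradient (signedDistBdry (obstacle P ψ)) p) (vertical n))⁻¹ ≤ K

/-- The localised gradient quantity `(U - ℓ)² v` at the point `p` of `M_t`, where `U` is the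
height. -/
def localisedGradient {n : ℕ} (ℓ : ℝ) (u : Base n → ℝ → ℝ) (t : ℝ) (p : Ambient n) : ℝ :=
  (p.snd - ℓ) ^ 2 * gradientFunction (fun y => u y t) p.fst

end

open Topology Filter

/-! ### Second-order conditions at local maxima -/

/-! Both claims are maximum principles for the scalar equation satisfied by `u`.

Gradient estimate: consider a space-time maximum of `log ((U - ℓ)² v) - δ t` at positive time and
height above `ℓ`. Write `p = |Du|`, `φ = U - ℓ` and let `e` be the direction of `Du`. Since `|∂ₑu| ≤
|Du|` with equality at the point, `v` may be replaced by `√(1 + (∂ₑu)²)`, so that the equation only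
has to be differentiated in the fixed direction `e`. The first-order condition determines `D∂ₑu`;
the second-order condition, traced with the inverse metric of the graph, removes the unknown second
and third derivatives (`trace_le_of_isLocalMax`, `hasDerivAt_graph_operator`). What remains is `δ ≤
2α/(φv) - 2(p² + 2)/(φ²v²) + (p/v) ∂ₑα`. If `v` exceeds the obstacle bound `K ≥ v_𝒪`, the graph is
steeper than the level sets of the distance, so moving up the graph leads out of the obstacle and
`∂ₑα ≤ 0`. Then `v < αφ ≤ K φ`. Hence `v ≤ max 1 (max K (s K))` at the maximum, where `s` bounds `U
- ℓ`; letting `δ → 0` gives the estimate.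

Existence of the maximum needs compactness of the track over bounded time intervals. Closedness and
compact slices alone do not exclude escape to infinity at a finite time; shrinking spheres do
(`IsPenalisedFlow.isCompact_track`). The bound `s` comes from comparison with horizontal planes
(`IsPenalisedFlow.height_le_sSup`).

Obstacle bound: the profile `β` is convex and unbounded, so at a large enough multiple of `ε` below
`∂𝒪` the penalisation beats the mean curvature of `∂𝒪`. A smooth function `d` of the height alone
(`exists_depth_function`) makes `ψ - ε d(ψ)` a barrier from below for small `ε`
(`IsPenalisedFlow.barrier_le`). Thus the flow enters the obstacle only to depth `ε d(ψ)`, where `α ≤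
β(-d(ψ))`. For small `ε` nearest boundary points are unique there, so the distance is
differentiable, with the normal of the graph of `ψ` at the foot point as gradient. As `d` involves
neither `ε` nor the truncation level, the resulting bound depends only on `ℓ`. -/

theorem second_deriv_nonpos_of_isLocalMax {g g' : ℝ → ℝ} {c s₀ : ℝ}
    (h : ∀ᶠ s in 𝓝 s₀, HasDerivAt g (g' s) s) (h' : HasDerivAt g' c s₀)
    (hmax : IsLocalMax g s₀) : c ≤ 0 := by
  by_contra! hc
  have e1 : deriv g =ᶠ[𝓝 s₀] g' := h.mono fun s hs => hs.deriv
  have e2 : deriv (deriv g) s₀ = c := by rw [e1.deriv_eq, h'.deriv]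
  -- With `c > 0` the point is also a local minimum, so `g` is locally constant and `c = 0`.
  have hmin : IsLocalMin g s₀ :=
    isLocalMin_of_deriv_deriv_pos (by rw [e2]; exact hc) hmax.deriv_eq_zero
      h.self_of_nhds.continuousAt
  have e3 : g =ᶠ[𝓝 s₀] fun _ => g s₀ := by
    filter_upwards [hmax, hmin] with s h1 h2 using le_antisymm h1 h2
  have e4 : deriv g =ᶠ[𝓝 s₀] fun _ => 0 := by
    have := e3.deriv
    simpa using this
  have := e4.deriv_eq
  rw [e2] at this
  simp at this
  exact hc.ne' this

theorem sum_smul_single {n : ℕ} (w : Base n) :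
    w = ∑ i, w i • EuclideanSpace.single i (1 : ℝ) := by
  ext j
  simp [Finset.sum_apply, Pi.single_apply]

theorem bilin_self_eq_sum {n : ℕ} (B : LinearMap.BilinForm ℝ (Base n)) (w : Base n) :
    B w w = ∑ i, ∑ j, w i * w j *
      B (EuclideanSpace.single i (1 : ℝ)) (EuclideanSpace.single j (1 : ℝ)) := by
  conv_lhs => rw [sum_smul_single w]
  simp only [map_sum, map_smul, LinearMap.sum_apply, LinearMap.smul_apply, smul_eq_mul,
    Finset.mul_sum]
  rw [Finset.sum_comm]
  refine Finset.sum_congr rfl fun i _ => Finset.sum_congr rfl fun j _ => by ring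

/-- As in the proof of Lagrange's identity, sum `B` over the vectors `w j • e i - w i • e j`: the
sum equals twice the difference of the two sides. Symmetry of `B` plays no role. -/
theorem bilin_self_le_norm_sq_mul_trace {n : ℕ} (B : LinearMap.BilinForm ℝ (Base n))
    (hB : ∀ v, 0 ≤ B v v) (w : Base n) :
    B w w ≤ ‖w‖ ^ 2 *
      ∑ i, B (EuclideanSpace.single i (1 : ℝ)) (EuclideanSpace.single i (1 : ℝ)) := by
  set e : Fin (n + 1) → Base n := fun i => EuclideanSpace.single i (1 : ℝ) with he
  have h0 : 0 ≤ ∑ i, ∑ j, B (w j • e i - w i • e j) (w j • e i - w i • e j) :=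
    Finset.sum_nonneg fun i _ => Finset.sum_nonneg fun j _ => hB _
  have hn : ‖w‖ ^ 2 = ∑ j, w j ^ 2 := EuclideanSpace.real_norm_sq_eq w
  have key : ∑ i, ∑ j, B (w j • e i - w i • e j) (w j • e i - w i • e j) =
      2 * ((∑ j, w j ^ 2) * ∑ i, B (e i) (e i)) - 2 * B w w := by
    have h1 : ∀ i j, B (w j • e i - w i • e j) (w j • e i - w i • e j) =
        w j ^ 2 * B (e i) (e i) + w i ^ 2 * B (e j) (e j)
          - w i * w j * B (e i) (e j) - w j * w i * B (e j) (e i) := by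
      intro i j
      simp only [map_sub, map_smul, LinearMap.sub_apply, LinearMap.smul_apply, smul_eq_mul]
      ring
    have hA : ∑ i, ∑ j, w j ^ 2 * B (e i) (e i) = (∑ j, w j ^ 2) * ∑ i, B (e i) (e i) := by
      rw [Finset.sum_comm, Finset.sum_mul_sum]
    have hA' : ∑ i, ∑ j, w i ^ 2 * B (e j) (e j) = (∑ j, w j ^ 2) * ∑ i, B (e i) (e i) := by
      rw [Finset.sum_mul_sum]
    have hC : ∑ i, ∑ j, w i * w j * B (e i) (e j) = B w w := (bilin_self_eq_sum B w).symm
    have hC' : ∑ i, ∑ j, w j * w i * B (e j) (e i) = B w w := by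
      rw [Finset.sum_comm]; exact hC
    simp only [h1, Finset.sum_sub_distrib, Finset.sum_add_distrib, hA, hA', hC, hC']
    ring
  rw [hn]
  linarith

/-- The trace of a positive semidefinite form with respect to the inverse metric
`I - w ⊗ w / (1 + |w|²)` of a graph is nonnegative. -/
theorem graph_trace_nonneg {n : ℕ} (B : LinearMap.BilinForm ℝ (Base n))
    (hB : ∀ v, 0 ≤ B v v) (w : Base n) :
    0 ≤ ∑ i, B (EuclideanSpace.single i (1 : ℝ)) (EuclideanSpace.single i (1 : ℝ)) -
      B w w / (1 + ‖w‖ ^ 2) := by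
  have h := bilin_self_le_norm_sq_mul_trace B hB w
  have ht : 0 ≤ ∑ i, B (EuclideanSpace.single i (1 : ℝ)) (EuclideanSpace.single i (1 : ℝ)) :=
    Finset.sum_nonneg fun i _ => hB _
  rw [sub_nonneg, div_le_iff₀ (by positivity)]
  nlinarith

/-! ### The mean curvature in nondivergence form -/

/-- The second derivative as a bilinear form. -/
noncomputable def hessian {n : ℕ} (f : Base n → ℝ) (x : Base n) :
    LinearMap.BilinForm ℝ (Base n) :=
  LinearMap.mk₂ ℝ (fun v w => fderiv ℝ (fderiv ℝ f) x v w) (by simp) (by simp) (by simp) (by simp)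

@[simp]
theorem hessian_apply {n : ℕ} (f : Base n → ℝ) (x v w : Base n) :
    hessian f x v w = fderiv ℝ (fderiv ℝ f) x v w := rfl

theorem inner_gradient {n : ℕ} (f : Base n → ℝ) (x v : Base n) :
    inner ℝ (gradient f x) v = fderiv ℝ f x v := by
  simp [gradient]

theorem gradient_apply {n : ℕ} (f : Base n → ℝ) (x : Base n) (i : Fin (n + 1)) :
    gradient f x i = fderiv ℝ f x (EuclideanSpace.single i (1 : ℝ)) := by
  rw [← inner_gradient, EuclideanSpace.inner_single_right]
  simp

theorem differentiableAt_gradient {n : ℕ} {f : Base n → ℝ} {x : Base n}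
    (hf : ContDiffAt ℝ 2 f x) : DifferentiableAt ℝ (gradient f) x := by
  rw [differentiableAt_euclidean]
  intro i
  simp only [gradient_apply]
  exact ((hf.fderiv_right (m := 1) (by norm_num)).differentiableAt (by norm_num)).clm_apply
    (differentiableAt_const _)

theorem inner_fderiv_gradient {n : ℕ} {f : Base n → ℝ} {x : Base n} (hf : ContDiffAt ℝ 2 f x)
    (v w : Base n) : inner ℝ (fderiv ℝ (gradient f) x v) w = fderiv ℝ (fderiv ℝ f) x v w := by
  have h1 := ((differentiableAt_gradient hf).hasFDerivAt.inner ℝ (hasFDerivAt_const w x)).fderiv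
  have hd : DifferentiableAt ℝ (fderiv ℝ f) x :=
    (hf.fderiv_right (m := 1) (by norm_num)).differentiableAt (by norm_num)
  have h2 := (hd.hasFDerivAt.clm_apply (hasFDerivAt_const w x)).fderiv
  have h3 : (fun y => inner ℝ (gradient f y) w) = fun y => fderiv ℝ f y w := by
    funext y; exact inner_gradient f y w
  rw [h3, h2] at h1
  have := congrArg (fun L => L v) h1
  simp [fderivInnerCLM_apply] at this
  exact this.symm

theorem meanCurvature_eq {n : ℕ} {f : Base n → ℝ} {x : Base n} (hf : ContDiffAt ℝ 2 f x) :
    meanCurvature f x = -((Real.sqrt (1 + ‖gradient f x‖ ^ 2))⁻¹ *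
      (∑ i, hessian f x (EuclideanSpace.single i (1 : ℝ)) (EuclideanSpace.single i (1 : ℝ)) -
        hessian f x (gradient f x) (gradient f x) / (1 + ‖gradient f x‖ ^ 2))) := by
  have hg := (differentiableAt_gradient hf).hasFDerivAt
  set D := fderiv ℝ (gradient f) x with hD
  set g := gradient f x with hgx
  have hpos : 0 < 1 + ‖g‖ ^ 2 := by positivity
  have hs : Real.sqrt (1 + ‖g‖ ^ 2) ≠ 0 := (Real.sqrt_pos.2 hpos).ne'
  have hq : HasFDerivAt (fun y => 1 + ‖gradient f y‖ ^ 2) (2 • (innerSL ℝ g).comp D) x := by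
    simpa using (hg.norm_sq).const_add 1
  have hr := (((Real.hasDerivAt_sqrt hpos.ne').inv hs).comp_hasFDerivAt x hq).smul hg
  have hsq : Real.sqrt (1 + ‖g‖ ^ 2) ^ 2 = 1 + ‖g‖ ^ 2 := Real.sq_sqrt hpos.le
  have hco : ∀ v i, D v i = fderiv ℝ (fderiv ℝ f) x v (EuclideanSpace.single i (1 : ℝ)) := by
    intro v i
    rw [← inner_fderiv_gradient hf]
    simp [EuclideanSpace.inner_single_right, hD]
  have hdg : ∀ v, inner ℝ g (D v) = hessian f x v g := by
    intro v
    rw [real_inner_comm, hD, inner_fderiv_gradient hf]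
    rfl
  have hlin : ∑ i, hessian f x (EuclideanSpace.single i (1 : ℝ)) g * g i = hessian f x g g := by
    conv_rhs => rw [show hessian f x g = hessian f x (∑ i, g i • EuclideanSpace.single i (1 : ℝ))
      by rw [← sum_smul_single g]]
    simp [map_sum, map_smul, LinearMap.sum_apply, mul_comm]
  unfold meanCurvature divergence
  rw [neg_inj]
  have hX : fderiv ℝ (fun y => (Real.sqrt (1 + ‖gradient f y‖ ^ 2))⁻¹ • gradient f y) x = _ :=
    hr.fderiv
  rw [hX]
  have hterm : ∀ a b c : ℝ, 0 < c → Real.sqrt c ^ 2 = c → (Real.sqrt c)⁻¹ * a +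
      -(1 / (2 * Real.sqrt c)) / c * (2 * b) = (Real.sqrt c)⁻¹ * (a - b / c) := by
    intro a b c hc _
    have : Real.sqrt c ≠ 0 := (Real.sqrt_pos.2 hc).ne'
    field_simp
    ring
  simp only [add_apply, smul_apply, PiLp.add_apply,
      PiLp.smul_apply, smul_eq_mul, ContinuousLinearMap.smulRight_apply, hco,
      ContinuousLinearMap.comp_apply, innerSL_apply_apply, hdg, hsq, nsmul_eq_mul]
  rw [← hlin, mul_sub, Finset.mul_sum, Finset.sum_div, Finset.mul_sum, ← Finset.sum_sub_distrib]
  refine Finset.sum_congr rfl fun i _ => ?_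
  rw [← mul_sub, ← hterm _ _ _ hpos hsq]
  simp
  ring

theorem hessian_nonneg_of_isLocalMin {n : ℕ} {f : Base n → ℝ} {x : Base n}
    (hf : ContDiffAt ℝ 2 f x) (hmin : IsLocalMin f x) (v : Base n) : 0 ≤ hessian f x v v := by
  have hline : ∀ s : ℝ, HasDerivAt (fun s : ℝ => x + s • v) v s := fun s => by
    simpa using ((hasDerivAt_id s).smul_const v).const_add x
  have ht : Tendsto (fun s : ℝ => x + s • v) (𝓝 0) (𝓝 x) := by
    simpa using (hline 0).continuousAt.tendsto
  have h1 : ∀ᶠ s in 𝓝 (0 : ℝ), HasDerivAt (fun s => -f (x + s • v))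
      (-fderiv ℝ f (x + s • v) v) s := by
    have : ∀ᶠ y in 𝓝 x, ContDiffAt ℝ 2 f y := hf.eventually (by norm_num)
    filter_upwards [ht.eventually this] with s hs
    exact ((hs.differentiableAt (by norm_num)).hasFDerivAt.comp_hasDerivAt s (hline s)).neg
  have h2 : HasDerivAt (fun s : ℝ => -fderiv ℝ f (x + s • v) v)
      (-fderiv ℝ (fderiv ℝ f) x v v) 0 := by
    have hd : DifferentiableAt ℝ (fderiv ℝ f) (x + (0 : ℝ) • v) := by
      simpa using (hf.fderiv_right (m := 1) (by norm_num)).differentiableAt (by norm_num)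
    have := hd.hasFDerivAt.comp_hasDerivAt 0 (hline 0)
    have h3 := (this.clm_apply (hasDerivAt_const (0 : ℝ) v)).fun_neg
    simpa using h3
  have h3 : IsLocalMax (fun s : ℝ => -f (x + s • v)) 0 := by
    have := ht.eventually hmin
    filter_upwards [this] with s hs
    simpa using hs
  have := second_deriv_nonpos_of_isLocalMax h1 h2 h3
  simpa using this

/-- Where graphs touch, the gradients and hence the inverse metrics agree, so the nondivergence form
compares the two Hessians by their trace with one positive matrix. -/
theorem meanCurvature_le_of_isLocalMin {n : ℕ} {f g : Base n → ℝ} {x : Base n}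
    (hf : ContDiffAt ℝ 2 f x) (hg : ContDiffAt ℝ 2 g x)
    (hmin : IsLocalMin (fun y => f y - g y) x) :
    gradient f x = gradient g x ∧ meanCurvature f x ≤ meanCurvature g x := by
  have e1 : ∀ᶠ y in 𝓝 x, fderiv ℝ (fun y => f y - g y) y = fderiv ℝ f y - fderiv ℝ g y := by
    filter_upwards [hf.eventually (by norm_num), hg.eventually (by norm_num)] with y h1 h2
    exact fderiv_sub (h1.differentiableAt (by norm_num)) (h2.differentiableAt (by norm_num))
  have hgrad : gradient f x = gradient g x := by
    have h0 := hmin.fderiv_eq_zero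
    rw [e1.self_of_nhds, sub_eq_zero] at h0
    simp [gradient, h0]
  refine ⟨hgrad, ?_⟩
  have hH : ∀ v w, hessian (fun y => f y - g y) x v w = hessian f x v w - hessian g x v w := by
    intro v w
    simp only [hessian_apply]
    rw [EventuallyEq.fderiv_eq e1, fderiv_fun_sub]
    · rfl
    · exact (hf.fderiv_right (m := 1) (by norm_num)).differentiableAt (by norm_num)
    · exact (hg.fderiv_right (m := 1) (by norm_num)).differentiableAt (by norm_num)
  have h := graph_trace_nonneg (hessian (fun y => f y - g y) x)
    (hessian_nonneg_of_isLocalMin (hf.sub hg) hmin) (gradient f x)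
  rw [meanCurvature_eq hf, meanCurvature_eq hg, ← hgrad, neg_le_neg_iff]
  refine mul_le_mul_of_nonneg_left ?_ (by positivity)
  simp only [hH, Finset.sum_sub_distrib] at h
  rw [sub_div] at h
  linarith

/-! ### Regularity of solutions -/

theorem gradientFunction_eq {n : ℕ} (f : Base n → ℝ) (x : Base n) :
    gradientFunction f x = Real.sqrt (1 + ‖gradient f x‖ ^ 2) := by
  simp [gradientFunction, graphNormal, vertical, point, inner_smul_left, WithLp.prod_inner_apply]

theorem one_le_gradientFunction {n : ℕ} (f : Base n → ℝ) (x : Base n) :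
    1 ≤ gradientFunction f x := by
  rw [gradientFunction_eq]
  exact Real.one_le_sqrt.2 (by nlinarith [sq_nonneg ‖gradient f x‖])

section Flow

variable {n : ℕ} {P : Set (Base n)} {ψ : Base n → ℝ} {β : ℝ → ℝ} {ε : ℝ}
  {Ω : Set (Base n × ℝ)} {u : Base n → ℝ → ℝ}

theorem IsPenalisedFlow.nonneg_time (h : IsPenalisedFlow P ψ β ε Ω u) {z : Base n × ℝ}
    (hz : z ∈ Ω) : 0 ≤ z.2 := by
  obtain ⟨G, -, rfl⟩ := h.domain
  exact hz.2

theorem IsPenalisedFlow.mem_nhdsWithin (h : IsPenalisedFlow P ψ β ε Ω u) {z : Base n × ℝ}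
    (hz : z ∈ Ω) : ∀ᶠ w in 𝓝 z, 0 ≤ w.2 → w ∈ Ω := by
  obtain ⟨G, hG, rfl⟩ := h.domain
  filter_upwards [hG.mem_nhds hz.1] with w hw h0 using ⟨hw, h0⟩

theorem IsPenalisedFlow.mem_nhds (h : IsPenalisedFlow P ψ β ε Ω u) {z : Base n × ℝ}
    (hz : z ∈ Ω) (ht : 0 < z.2) : Ω ∈ 𝓝 z := by
  filter_upwards [h.mem_nhdsWithin hz, continuousAt_snd.eventually (lt_mem_nhds ht)] with w h1 h2
  exact h1 h2.le

theorem IsPenalisedFlow.slice_mem_nhds (h : IsPenalisedFlow P ψ β ε Ω u) {x : Base n} {t : ℝ}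
    (hz : (x, t) ∈ Ω) : ∀ᶠ y in 𝓝 x, (y, t) ∈ Ω := by
  have hc : Tendsto (fun y : Base n => (y, t)) (𝓝 x) (𝓝 (x, t)) :=
    (Continuous.prodMk continuous_id continuous_const).tendsto x
  filter_upwards [hc.eventually (h.mem_nhdsWithin hz)] with y hy using hy (h.nonneg_time hz)

theorem IsPenalisedFlow.contDiffAt (h : IsPenalisedFlow P ψ β ε Ω u) {z : Base n × ℝ}
    (hz : z ∈ Ω) (ht : 0 < z.2) : ContDiffAt ℝ ∞ (fun z : Base n × ℝ => u z.1 z.2) z :=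
  h.smooth.contDiffAt (h.mem_nhds hz ht)

theorem ContDiffAt.slice {W : Base n × ℝ → ℝ} {x : Base n} {t : ℝ} {k : ℕ∞ω}
    (h : ContDiffAt ℝ k W (x, t)) : ContDiffAt ℝ k (fun y => W (y, t)) x :=
  ContDiffAt.comp (f := fun y : Base n => (y, t)) x h (contDiffAt_id.prodMk contDiffAt_const)

theorem IsPenalisedFlow.contDiffAt_slice (h : IsPenalisedFlow P ψ β ε Ω u) {x : Base n} {t : ℝ}
    (hz : (x, t) ∈ Ω) (ht : 0 < t) : ContDiffAt ℝ ∞ (fun y => u y t) x :=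
  (h.contDiffAt hz ht).slice

theorem IsPenalisedFlow.hasDerivAt_time (h : IsPenalisedFlow P ψ β ε Ω u) {x : Base n} {t : ℝ}
    (hz : (x, t) ∈ Ω) (ht : 0 < t) : HasDerivAt (fun s => u x s)
      (Real.sqrt (1 + ‖gradient (fun y => u y t) x‖ ^ 2) *
        (-meanCurvature (fun y => u y t) x +
          penalisation β ε (obstacle P ψ) (point x (u x t)))) t := by
  have hd : DifferentiableAt ℝ (fun s => u x s) t := by
    have := (h.contDiffAt hz ht).differentiableAt (by norm_num)
    exact DifferentiableAt.comp t (f := fun s : ℝ => (x, s)) this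
      ((differentiableAt_const x).prodMk differentiableAt_id)
  have := h.evolution x t hz
  rw [derivWithin_of_mem_nhds (Ici_mem_nhds ht)] at this
  have h2 := hd.hasDerivAt
  rw [this, neg_mul, ← mul_neg, neg_sub, sub_eq_neg_add] at h2
  exact h2

theorem IsPenalisedFlow.uniqueDiffOn (h : IsPenalisedFlow P ψ β ε Ω u) : UniqueDiffOn ℝ Ω := by
  obtain ⟨G, hG, rfl⟩ := h.domain
  have h1 : UniqueDiffOn ℝ {z : Base n × ℝ | 0 ≤ z.2} := by
    have : {z : Base n × ℝ | 0 ≤ z.2} = Set.univ ×ˢ Set.Ici 0 := by ext; simp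
    rw [this]
    exact uniqueDiffOn_univ.prod (uniqueDiffOn_Ici 0)
  rw [Set.inter_comm]
  exact h1.inter hG

theorem IsPenalisedFlow.continuousOn (h : IsPenalisedFlow P ψ β ε Ω u) :
    ContinuousOn (fun z : Base n × ℝ => u z.1 z.2) Ω := h.smooth.continuousOn

/-- The point is continuity up to `t = 0`, where only derivatives within `Ω` are controlled. Time
slices of `Ω` are open in space, so the spatial part of that derivative is the ordinary gradient of
the slice. -/
theorem IsPenalisedFlow.continuousOn_gradient (h : IsPenalisedFlow P ψ β ε Ω u) :
    ContinuousOn (fun z : Base n × ℝ => gradient (fun y => u y z.2) z.1) Ω := by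
  have h1 : ContinuousOn (fderivWithin ℝ (fun z : Base n × ℝ => u z.1 z.2) Ω) Ω :=
    h.smooth.continuousOn_fderivWithin h.uniqueDiffOn (by norm_num)
  have h2 : ContinuousOn (fun z => (InnerProductSpace.toDual ℝ (Base n)).symm
      ((fderivWithin ℝ (fun z : Base n × ℝ => u z.1 z.2) Ω z).comp
        (ContinuousLinearMap.inl ℝ (Base n) ℝ))) Ω :=
    (LinearIsometryEquiv.continuous _).comp_continuousOn (h1.clm_comp continuousOn_const)
  refine h2.congr ?_
  rintro ⟨x, t⟩ hz
  have hd := ((h.smooth.differentiableOn (by norm_num)) (x, t) hz).hasFDerivWithinAt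
  have hl : HasFDerivAt (fun y : Base n => (y, t)) (ContinuousLinearMap.inl ℝ (Base n) ℝ) x :=
    hasFDerivAt_prodMk_left x t
  have := hd.comp x (hl.hasFDerivWithinAt (s := {y | (y, t) ∈ Ω})) (fun y hy => hy)
  have h3 := (this.hasFDerivAt (h.slice_mem_nhds hz)).fderiv
  simp only [gradient]
  congr 1

/-! ### Coordinates of the ambient space. -/

theorem point_fst_snd (p : Ambient n) : point p.fst p.snd = p := rfl

@[simp] theorem point_fst (x : Base n) (y : ℝ) : (point x y).fst = x := rfl

@[simp] theorem point_snd (x : Base n) (y : ℝ) : (point x y).snd = y := rfl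

theorem continuous_fst_ambient : Continuous (fun p : Ambient n => p.fst) :=
  continuous_fst.comp (WithLp.prod_continuous_ofLp 2 _ _)

theorem continuous_snd_ambient : Continuous (fun p : Ambient n => p.snd) :=
  continuous_snd.comp (WithLp.prod_continuous_ofLp 2 _ _)

theorem isOpen_obstacle (h : IsObstacle P ψ) : IsOpen (obstacle P ψ) := by
  rw [isOpen_iff_mem_nhds]
  rintro p ⟨h1, h2⟩
  have hc : ContinuousAt (fun q : Ambient n => ψ q.fst) p :=
    ContinuousAt.comp (f := fun q : Ambient n => q.fst)
      (h.smooth.continuousOn.continuousAt (h.isOpen.mem_nhds h1))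
      continuous_fst_ambient.continuousAt
  filter_upwards [continuous_fst_ambient.continuousAt.eventually (h.isOpen.mem_nhds h1),
    continuous_snd_ambient.continuousAt.eventually_lt hc h2] with q h3 h4 using ⟨h3, h4⟩

/-! ### Penalty profiles -/

theorem IsPenaltyProfile.eq_zero_of_pos (h : IsPenaltyProfile β) {s : ℝ} (hs : 0 < s) :
    β s = 0 := by
  by_contra h0
  have := h.support (subset_tsupport β h0)
  exact absurd this (not_le.2 hs)

theorem IsPenaltyProfile.eq_zero (h : IsPenaltyProfile β) {s : ℝ} (hs : 0 ≤ s) :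
    β s = 0 := by
  have hcl : IsClosed {s | β s = 0} := isClosed_eq h.smooth.continuous continuous_const
  have : Set.Ici (0 : ℝ) ⊆ {s | β s = 0} := by
    rw [← closure_Ioi]
    exact hcl.closure_subset_iff.2 fun s hs => h.eq_zero_of_pos hs
  exact this hs

theorem IsPenaltyProfile.differentiable (h : IsPenaltyProfile β) : Differentiable ℝ β :=
  h.smooth.differentiable (by norm_num)

theorem IsPenaltyProfile.contDiff_deriv (h : IsPenaltyProfile β) : ContDiff ℝ ∞ (deriv β) :=
  (contDiff_infty_iff_deriv.1 h.smooth).2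

theorem IsPenaltyProfile.deriv_eq_zero (h : IsPenaltyProfile β) {s : ℝ} (hs : 0 ≤ s) :
    deriv β s = 0 := by
  have hcl : IsClosed {s | deriv β s = 0} :=
    isClosed_eq h.contDiff_deriv.continuous continuous_const
  have : Set.Ici (0 : ℝ) ⊆ {s | deriv β s = 0} := by
    rw [← closure_Ioi]
    refine hcl.closure_subset_iff.2 fun s hs => ?_
    have : β =ᶠ[𝓝 s] fun _ => 0 := by
      filter_upwards [lt_mem_nhds hs] with r hr using h.eq_zero_of_pos hr
    have := this.deriv_eq
    simpa using this
  exact this hs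

/-- The second derivative is non-increasing and vanishes far to the right, hence is nonnegative
everywhere. So `β` is convex. -/
theorem IsPenaltyProfile.monotone_deriv (h : IsPenaltyProfile β) : Monotone (deriv β) := by
  have hd : Differentiable ℝ (deriv β) := h.contDiff_deriv.differentiable (by norm_num)
  refine monotone_of_deriv_nonneg hd fun s => ?_
  have h1 : deriv (deriv β) (max s 0 + 1) = 0 := by
    have : deriv β =ᶠ[𝓝 (max s 0 + 1)] fun _ => 0 := by
      filter_upwards [lt_mem_nhds (show 0 < max s 0 + 1 by positivity)] with r hr
        using h.deriv_eq_zero hr.le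
    have := this.deriv_eq
    simpa using this
  rw [← h1]
  exact h.antitone (by linarith [le_max_left s 0])

theorem IsPenaltyProfile.deriv_nonpos (h : IsPenaltyProfile β) (s : ℝ) : deriv β s ≤ 0 := by
  rw [← h.deriv_eq_zero (le_max_right s 0)]
  exact h.monotone_deriv (le_max_left s 0)

theorem IsPenaltyProfile.antitone_self (h : IsPenaltyProfile β) : Antitone β :=
  antitone_of_deriv_nonpos h.differentiable h.deriv_nonpos

/-- A penalty profile is unbounded, being convex and nontrivial. -/
theorem IsPenaltyProfile.exists_lt (h : IsPenaltyProfile β) (A : ℝ) :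
    ∃ s₀ > 0, ∀ s, s₀ ≤ s → A < β (-s) := by
  have hconv : ConvexOn ℝ Set.univ β := h.monotone_deriv.convexOn_univ_of_deriv h.differentiable
  obtain ⟨a, ha⟩ := h.nontrivial
  have ha0 : a < 0 := by
    by_contra! h0
    exact ha (h.eq_zero h0)
  have hpos : 0 < β a := lt_of_le_of_ne (h.nonneg a) (Ne.symm ha)
  -- Convexity between `k * a` and `0`, with `β 0 = 0`, gives `β (k * a) ≥ k * β a = |A| + β a > A`.
  set k : ℝ := |A| / β a + 1 with hk
  have hk1 : 1 ≤ k := by rw [hk]; linarith [div_nonneg (abs_nonneg A) hpos.le]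
  refine ⟨k * (-a), mul_pos (by linarith) (by linarith), fun s hs => ?_⟩
  have h1 : β (k * a) ≤ β (-s) := h.antitone_self (by linarith)
  have h2 := hconv.2 (Set.mem_univ (k * a)) (Set.mem_univ 0)
    (by positivity : 0 ≤ k⁻¹) (sub_nonneg.2 (inv_le_one_of_one_le₀ hk1)) (by ring)
  have hk0 : k ≠ 0 := by positivity
  simp only [smul_eq_mul, mul_zero, add_zero, h.eq_zero le_rfl] at h2
  rw [inv_mul_cancel_left₀ hk0] at h2
  rw [inv_mul_eq_div, le_div_iff₀ (by positivity)] at h2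
  have h3 : β a * k = |A| + β a := by rw [hk]; field_simp
  linarith [le_abs_self A]

theorem penalisation_nonneg (h : IsPenaltyProfile β) (A : Set (Ambient n)) (p : Ambient n) :
    0 ≤ penalisation β ε A p := h.nonneg _

theorem penalisation_eq_zero (h : IsPenaltyProfile β) (hε : 0 < ε) {A : Set (Ambient n)}
    {p : Ambient n} (hp : p ∉ A) : penalisation β ε A p = 0 := by
  unfold penalisation signedDistBdry
  rw [if_neg hp]
  exact h.eq_zero (div_nonneg Metric.infDist_nonneg hε.le)

end Flow

/-! ### Sphere barriers and compactness of the track -/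

/-- The parabolic form of the first-derivative test: at a first contact, or at the final time, only
earlier times are available for comparison. -/
theorem deriv_nonneg_of_left_max {f : ℝ → ℝ} {f' t : ℝ} (hf : HasDerivAt f f' t)
    (hmax : ∀ᶠ s in 𝓝 t, s ≤ t → f s ≤ f t) : 0 ≤ f' := by
  have h1 : Tendsto (slope f t) (𝓝[<] t) (𝓝 f') :=
    (hasDerivWithinAt_iff_tendsto_slope' (by simp)).1 hf.hasDerivWithinAt
  refine ge_of_tendsto h1 ?_
  filter_upwards [nhdsWithin_le_nhds hmax, self_mem_nhdsWithin] with s hs hlt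
  rw [slope_def_field]
  exact div_nonneg_of_nonpos (by linarith [hs (le_of_lt hlt)]) (by linarith [Set.mem_Iio.1 hlt])

/-- Trace the Hessian of the squared distance with the inverse metric of the graph: the position
part contributes `2 (n + 1)` and the rest is the curvature term. Along the flow without penalisation
this says that, at a spatial minimum, the squared distance to the centre decreases at rate at most
`2 (n + 1)`. -/
theorem sphere_contact {n : ℕ} {f : Base n → ℝ} {x x₀ : Base n} {y₀ : ℝ}
    (hf : ContDiffAt ℝ 2 f x)
    (hmin : IsLocalMin (fun y => ‖y - x₀‖ ^ 2 + (f y - y₀) ^ 2) x) :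
    -(n + 1 : ℝ) ≤ (f x - y₀) *
      (Real.sqrt (1 + ‖gradient f x‖ ^ 2) * -meanCurvature f x) := by
  set q : Base n → ℝ := fun y => ‖y - x₀‖ ^ 2 + (f y - y₀) ^ 2 with hq
  have hqd : ContDiffAt ℝ 2 q x :=
    ((contDiffAt_id.sub contDiffAt_const).norm_sq ℝ).add ((hf.sub contDiffAt_const).pow 2)
  have e1 : ∀ᶠ y in 𝓝 x, fderiv ℝ q y =
      2 • (innerSL ℝ (y - x₀)) + (2 * (f y - y₀)) • fderiv ℝ f y := by
    filter_upwards [hf.eventually (by norm_num)] with y hy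
    have h1 := (hy.differentiableAt (by norm_num)).hasFDerivAt
    have h2 := ((hasFDerivAt_id y).sub_const x₀).norm_sq.add ((h1.sub_const y₀).pow 2)
    rw [hq]
    refine h2.fderiv.trans ?_
    ext v
    simp
  have hd : DifferentiableAt ℝ (fderiv ℝ f) x :=
    (hf.fderiv_right (m := 1) (by norm_num)).differentiableAt (by norm_num)
  have hH : ∀ v w, hessian q x v w = 2 * inner ℝ v w + 2 * (fderiv ℝ f x v * fderiv ℝ f x w)
      + 2 * (f x - y₀) * hessian f x v w := by
    intro v w
    rw [hessian_apply, EventuallyEq.fderiv_eq e1]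
    have h1 : HasFDerivAt (fun y : Base n => innerSL ℝ (y - x₀)) (innerSL ℝ) x :=
      (innerSL ℝ : Base n →L[ℝ] _).hasFDerivAt.comp x ((hasFDerivAt_id x).sub_const x₀)
    have h2 : HasFDerivAt (fun y => 2 * (f y - y₀)) ((2 : ℝ) • fderiv ℝ f x) x :=
      ((hf.differentiableAt (by norm_num)).hasFDerivAt.sub_const y₀).const_mul 2
    have h3 := ((h1.const_smul 2).add (h2.smul hd.hasFDerivAt)).fderiv
    refine (congrArg (fun L => L v w) h3).trans ?_
    have h4 : innerSL ℝ v w = inner ℝ v w := rfl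
    simp [h4]
    ring
  have htr := graph_trace_nonneg (hessian q x) (hessian_nonneg_of_isLocalMin hqd hmin)
    (gradient f x)
  have hg : fderiv ℝ f x (gradient f x) = ‖gradient f x‖ ^ 2 := by
    rw [← inner_gradient, real_inner_self_eq_norm_sq]
  have hsum : ∑ i, fderiv ℝ f x (EuclideanSpace.single i (1 : ℝ)) *
      fderiv ℝ f x (EuclideanSpace.single i (1 : ℝ)) = ‖gradient f x‖ ^ 2 := by
    rw [EuclideanSpace.real_norm_sq_eq]
    simp only [gradient_apply, sq]
  simp only [hH, Finset.sum_add_distrib, ← Finset.mul_sum, hsum, hg,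
    real_inner_self_eq_norm_sq] at htr
  rw [meanCurvature_eq hf, neg_neg]
  have hpos : 0 < 1 + ‖gradient f x‖ ^ 2 := by positivity
  rw [mul_inv_cancel_left₀ (Real.sqrt_pos.2 hpos).ne']
  have hone : ∑ i : Fin (n + 1), ‖(EuclideanSpace.single i (1 : ℝ) : Base n)‖ ^ 2 =
      (n + 1 : ℝ) := by simp
  rw [hone] at htr
  set S := ∑ i, hessian f x (EuclideanSpace.single i (1 : ℝ)) (EuclideanSpace.single i (1 : ℝ))
  set H := hessian f x (gradient f x) (gradient f x)
  set G := ‖gradient f x‖ ^ 2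
  have h1 : 2 * (n + 1 : ℝ) + 2 * G + 2 * (f x - y₀) * S -
      (2 * G + 2 * (G * G) + 2 * (f x - y₀) * H) / (1 + G) =
      2 * ((n + 1 : ℝ) + (f x - y₀) * (S - H / (1 + G))) := by
    field_simp
    ring
  rw [h1] at htr
  linarith

section Flow

variable {n : ℕ} {P : Set (Base n)} {ψ : Base n → ℝ} {β : ℝ → ℝ} {ε : ℝ}
  {Ω : Set (Base n × ℝ)} {u : Base n → ℝ → ℝ}

theorem dist_sq_point (p : Ambient n) (x : Base n) (y : ℝ) :
    dist p (point x y) ^ 2 = ‖p.fst - x‖ ^ 2 + (p.snd - y) ^ 2 := by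
  rw [dist_eq_norm, WithLp.prod_norm_sq_eq_of_L2]
  simp

/-- Shrinking spheres in a region where the penalisation vanishes are avoided by the flow. -/
theorem IsPenalisedFlow.sphere_avoidance (h : IsPenalisedFlow P ψ β ε Ω u) {lev k ρ c y₀ : ℝ}
    {x₀ : Base n} (hk : 0 ≤ k) (hρ : 0 ≤ ρ) (hc : 2 * (n + 1 : ℝ) < c) (hlev : lev ≤ y₀ - ρ)
    (hclosed : IsClosed {z : Ambient n × ℝ | 0 ≤ z.2 ∧ z.1 ∈ surface Ω u z.2 ∧ lev ≤ z.1.snd})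
    (hstart : ∀ x, (x, k) ∈ Ω → ρ ^ 2 < ‖x - x₀‖ ^ 2 + (u x k - y₀) ^ 2)
    (hpen : ∀ x y, ‖x - x₀‖ ^ 2 + (y - y₀) ^ 2 ≤ ρ ^ 2 →
      penalisation β ε (obstacle P ψ) (point x y) = 0) :
    ∀ x t, (x, t) ∈ Ω → k ≤ t → ρ ^ 2 < ‖x - x₀‖ ^ 2 + (u x t - y₀) ^ 2 + c * (t - k) := by
  have hc0 : 0 < c := lt_trans (by positivity) hc
  set Q : Base n × ℝ → ℝ := fun z => ‖z.1 - x₀‖ ^ 2 + (u z.1 z.2 - y₀) ^ 2 + c * (z.2 - k) with hQ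
  -- The set of violations. It is compact because the balls stay above `lev`, where the track is
  -- closed, and have disappeared after time `ρ ^ 2 / c`. The contradiction arises at its earliest
  -- time.
  set S : Set (Base n × ℝ) := {z | z ∈ Ω ∧ k ≤ z.2 ∧ Q z ≤ ρ ^ 2} with hS
  have hScomp : IsCompact S := by
    have h1 : IsCompact ({z : Ambient n × ℝ | 0 ≤ z.2 ∧ z.1 ∈ surface Ω u z.2 ∧ lev ≤ z.1.snd} ∩
        {z | k ≤ z.2 ∧ dist z.1 (point x₀ y₀) ^ 2 + c * (z.2 - k) ≤ ρ ^ 2}) := by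
      refine Metric.isCompact_of_isClosed_isBounded (hclosed.inter ?_) ?_
      · have hc1 : Continuous fun z : Ambient n × ℝ =>
            dist z.1 (point x₀ y₀) ^ 2 + c * (z.2 - k) :=
          ((continuous_fst.dist continuous_const).pow 2).add
            (continuous_const.mul (continuous_snd.sub continuous_const))
        exact (isClosed_le continuous_const continuous_snd).inter
          (isClosed_le hc1 continuous_const)
      · refine ((Metric.isBounded_closedBall (x := point x₀ y₀) (r := ρ)).prod
          (Metric.isBounded_Icc k (k + ρ ^ 2 / c))).subset ?_
        rintro ⟨p, t⟩ ⟨-, h1, h2⟩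
        simp only at h1 h2
        have h3 : 0 ≤ c * (t - k) := mul_nonneg hc0.le (by linarith)
        refine ⟨?_, h1, ?_⟩
        · rw [Metric.mem_closedBall]
          exact abs_le_of_sq_le_sq' (by linarith) hρ |>.2
        · have : c * (t - k) ≤ ρ ^ 2 := by nlinarith [sq_nonneg (dist p (point x₀ y₀))]
          rw [mul_comm, ← le_div_iff₀ hc0] at this
          linarith
    have h2 := h1.image (f := fun z : Ambient n × ℝ => (z.1.fst, z.2))
      ((continuous_fst_ambient.comp continuous_fst).prodMk continuous_snd)
    convert h2 using 1
    ext ⟨x, t⟩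
    constructor
    · rintro ⟨hz, h1, h2⟩
      refine ⟨(point x (u x t), t), ⟨⟨h.nonneg_time hz, ⟨hz, rfl⟩, ?_⟩, h1, ?_⟩, rfl⟩
      · have h3 : 0 ≤ c * (t - k) := mul_nonneg hc0.le (by linarith)
        have h4 : (u x t - y₀) ^ 2 ≤ ρ ^ 2 := by
          simp only [hQ] at h2
          nlinarith [sq_nonneg ‖x - x₀‖]
        have := (abs_le_of_sq_le_sq' h4 hρ).1
        simp only [point_snd]
        linarith
      · simpa only [dist_sq_point, point_fst, point_snd, hQ] using h2
    · rintro ⟨⟨p, s⟩, ⟨⟨-, ⟨h1, h1'⟩, -⟩, h2, h3⟩, he⟩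
      simp only [Prod.mk.injEq] at he
      obtain ⟨rfl, rfl⟩ := he
      refine ⟨h1, h2, ?_⟩
      simp only [hQ, ← h1']
      rw [← point_fst_snd p, dist_sq_point] at h3
      exact h3
  have hSempty : ¬ S.Nonempty := by
    intro hne
    obtain ⟨⟨x₁, t₁⟩, ⟨hz, hkt, hQ1⟩, hmin⟩ := hScomp.exists_isMinOn hne continuous_snd.continuousOn
    simp only at hkt
    have hlt : k < t₁ := by
      refine lt_of_le_of_ne hkt fun he => ?_
      subst he
      have := hstart x₁ hz
      simp only [hQ, sub_self, mul_zero, add_zero] at hQ1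
      linarith
    have ht0 : 0 < t₁ := lt_of_le_of_lt hk hlt
    have hΩ := h.mem_nhds hz ht0
    have hQc : ∀ z ∈ Ω, ContinuousWithinAt Q Ω z := by
      intro z hz
      have := h.continuousOn z hz
      exact (((continuous_fst.sub continuous_const).norm.pow 2).continuousWithinAt.add
        ((this.sub continuousWithinAt_const).pow 2)).add
        (continuous_const.mul (continuous_snd.sub continuous_const)).continuousWithinAt
    have hearly : ∀ z ∈ Ω, k ≤ z.2 → z.2 < t₁ → ρ ^ 2 < Q z := by
      intro z hz1 hz2 hz3
      by_contra! hle
      exact absurd (hmin ⟨hz1, hz2, hle⟩) (not_le.2 hz3)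
    -- Minimality of `t₁` controls strictly earlier times only; points at time `t₁` are reached as
    -- limits from the past.
    have hev : ∀ᶠ z in 𝓝 (x₁, t₁), z.2 ≤ t₁ → ρ ^ 2 ≤ Q z := by
      filter_upwards [eventually_mem_nhds_iff.2 hΩ,
        continuousAt_snd.eventually (lt_mem_nhds hlt)] with z hz1 hz2 hz3
      rcases hz3.lt_or_eq with h3 | h3
      · exact (hearly z (mem_of_mem_nhds hz1) hz2.le h3).le
      · have hcont : ContinuousAt Q z :=
          (hQc z (mem_of_mem_nhds hz1)).continuousAt hz1
        have htd : Tendsto (fun s : ℝ => (z.1, s)) (𝓝[<] t₁) (𝓝 z) := by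
          have : Continuous fun s : ℝ => (z.1, s) := by fun_prop
          have h5 := (this.tendsto t₁).mono_left (nhdsWithin_le_nhds (s := Set.Iio t₁))
          rwa [← h3] at h5 ⊢
        refine ge_of_tendsto (hcont.tendsto.comp htd) ?_
        filter_upwards [htd.eventually hz1, self_mem_nhdsWithin,
          nhdsWithin_le_nhds (lt_mem_nhds hlt)] with s h6 h7 h8
        exact (hearly (z.1, s) h6 h8.le h7).le
    have hQeq : Q (x₁, t₁) = ρ ^ 2 := le_antisymm hQ1 (hev.self_of_nhds le_rfl)
    have hspace : IsLocalMin (fun y => ‖y - x₀‖ ^ 2 + (u y t₁ - y₀) ^ 2) x₁ := by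
      have hc : Tendsto (fun y : Base n => (y, t₁)) (𝓝 x₁) (𝓝 (x₁, t₁)) :=
        (Continuous.prodMk continuous_id continuous_const).tendsto x₁
      filter_upwards [hc.eventually hev] with y hy
      have := hy le_rfl
      rw [← hQeq] at this
      simp only [hQ] at this
      linarith
    have h1 := sphere_contact ((h.contDiffAt_slice hz ht0).of_le (by norm_cast)) hspace
    have h2 := h.hasDerivAt_time hz ht0
    have hp : penalisation β ε (obstacle P ψ) (point x₁ (u x₁ t₁)) = 0 := by
      refine hpen _ _ ?_
      rw [← hQeq]
      have : 0 ≤ c * (t₁ - k) := mul_nonneg hc0.le (by linarith)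
      simp only [hQ]
      linarith
    rw [hp, add_zero] at h2
    have h3 := ((((h2.sub_const y₀).fun_pow 2).const_add (‖x₁ - x₀‖ ^ 2)).fun_add
      (((hasDerivAt_id t₁).sub_const k).const_mul c)).fun_neg
    have h4 := deriv_nonneg_of_left_max h3 (by
      have hc : Tendsto (fun s : ℝ => (x₁, s)) (𝓝 t₁) (𝓝 (x₁, t₁)) :=
        (Continuous.prodMk continuous_const continuous_id).tendsto t₁
      filter_upwards [hc.eventually hev] with s hs hle
      have := hs hle
      rw [← hQeq] at this
      simp only [hQ] at this
      simp only [id]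
      linarith)
    simp at h4
    nlinarith
  intro x t hz hkt
  by_contra! hle
  exact hSempty ⟨(x, t), hz, hkt, hle⟩

/-- The upper bound on `ψ` turns a half-line into a compact interval, to which properness applies.
-/
theorem IsObstacle.isCompact_superlevel (h : IsObstacle P ψ) (m : ℝ) :
    IsCompact {x | x ∈ P ∧ m ≤ ψ x} := by
  obtain ⟨B, hB⟩ := h.bddAbove
  have h1 := h.proper.isCompact_preimage (isCompact_Icc (a := m) (b := B))
  have h2 := h1.image continuous_subtype_val
  convert h2 using 1
  ext x
  constructor
  · rintro ⟨hx, hm⟩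
    exact ⟨⟨x, hx⟩, ⟨hm, hB ⟨x, hx, rfl⟩⟩, rfl⟩
  · rintro ⟨⟨y, hy⟩, hy2, rfl⟩
    exact ⟨hy, hy2.1⟩

/-- Only boundedness is at stake. Far from the slice at an integer time `k` and from the part of the
obstacle above `lev - a`, a large sphere is initially disjoint from the flow and sees no
penalisation. It therefore keeps the flow away during `[k, k + 1]`; finitely many such intervals
cover `[0, T]`. -/
theorem IsPenalisedFlow.isCompact_track (h : IsPenalisedFlow P ψ β ε Ω u) (hψ : IsObstacle P ψ)
    (hβ : IsPenaltyProfile β) (hε : 0 < ε) {lev a : ℝ} (ha : 0 < a)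
    (hclosed : IsClosed
      {z : Ambient n × ℝ | 0 ≤ z.2 ∧ z.1 ∈ surface Ω u z.2 ∧ lev - a ≤ z.1.snd})
    (hcomp : ∀ t, 0 ≤ t → IsCompact {p ∈ surface Ω u t | lev - a ≤ p.snd}) (T : ℝ) {m : ℝ}
    (hm : lev - a / 2 ≤ m) : IsCompact {z ∈ Ω | z.2 ≤ T ∧ m ≤ u z.1 z.2} := by
  set c : ℝ := 2 * (n + 1 : ℝ) + 1 with hc
  have hc0 : 0 < c := by positivity
  -- The ball of radius `R + a / 2` about the point at height `R` above a given surface point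
  -- reaches only `a / 2` below that point. With `R * a = c` its shrinking sphere still encloses the
  -- point after unit time.
  set R : ℝ := c / a with hR
  have hR0 : 0 < R := by positivity
  have hRa : R * a = c := by rw [hR]; field_simp
  obtain ⟨B, hB⟩ := hψ.bddAbove
  have hbd : ∀ k : ℕ, ∃ M : ℝ, ∀ x t, (x, t) ∈ Ω → (k : ℝ) ≤ t → t ≤ k + 1 →
      lev - a / 2 ≤ u x t → ‖x‖ ≤ M ∧ u x t ≤ M := by
    intro k
    obtain ⟨M₁, hM₁⟩ := (hψ.isCompact_superlevel (lev - a)).isBounded.exists_norm_le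
    obtain ⟨M₂, hM₂⟩ := ((hcomp k (by positivity)).image continuous_fst_ambient).isBounded.exists_norm_le
    obtain ⟨M₃, hM₃⟩ := ((hcomp k (by positivity)).image continuous_snd_ambient).isBounded.exists_norm_le
    set M : ℝ := max (max M₁ M₂) (max M₃ B) with hM
    have hMle : M₁ ≤ M ∧ M₂ ≤ M ∧ M₃ ≤ M ∧ B ≤ M := by simp [hM]
    refine ⟨M + R + a, fun x t hz hkt htk hu => ?_⟩
    by_contra hcon
    have hfar : ∀ x' y' : _, ‖x' - x‖ ^ 2 + (y' - (u x t + R)) ^ 2 ≤ (R + a / 2) ^ 2 →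
        lev - a ≤ y' ∧ ¬ (‖x'‖ ≤ M ∧ y' ≤ M) := by
      intro x' y' hle
      have h1 : (y' - (u x t + R)) ^ 2 ≤ (R + a / 2) ^ 2 := by nlinarith [sq_nonneg ‖x' - x‖]
      have h2 : ‖x' - x‖ ^ 2 ≤ (R + a / 2) ^ 2 := by
        nlinarith [sq_nonneg (y' - (u x t + R))]
      have h3 := (abs_le_of_sq_le_sq' h1 (by positivity)).1
      have h4 := (abs_le_of_sq_le_sq' h2 (by positivity)).2
      refine ⟨by linarith, fun ⟨h5, h6⟩ => hcon ⟨?_, ?_⟩⟩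
      · have : ‖x‖ ≤ ‖x'‖ + ‖x' - x‖ := by
          have := norm_sub_le x' (x' - x)
          simpa using this
        linarith
      · linarith
    have := h.sphere_avoidance (k := k) (ρ := R + a / 2) (c := c) (y₀ := u x t + R) (x₀ := x)
      (by positivity) (by positivity) (by linarith) (by linarith) hclosed
      (fun x' hx' => by
        by_contra! hle
        obtain ⟨h1, h2⟩ := hfar _ _ hle
        have hmem : point x' (u x' k) ∈ {p ∈ surface Ω u k | lev - a ≤ p.snd} :=
          ⟨⟨hx', rfl⟩, h1⟩
        refine h2 ⟨?_, ?_⟩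
        · exact (hM₂ _ ⟨_, hmem, rfl⟩).trans hMle.2.1
        · exact ((le_abs_self _).trans (hM₃ _ ⟨_, hmem, rfl⟩)).trans hMle.2.2.1)
      (fun x' y' hle => by
        obtain ⟨h1, h2⟩ := hfar _ _ hle
        refine penalisation_eq_zero hβ hε fun hmem => h2 ?_
        obtain ⟨h3, h4⟩ := hmem
        simp only [point_fst, point_snd] at h3 h4
        exact ⟨(hM₁ _ ⟨h3, by linarith⟩).trans hMle.1,
          (h4.le.trans (hB ⟨_, h3, rfl⟩)).trans hMle.2.2.2⟩)
      x t hz hkt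
    -- Avoidance now reads `(R + a / 2) ^ 2 < R ^ 2 + c * (t - k)`, while the right side is at most
    -- `R ^ 2 + R * a`.
    simp only [sub_self, norm_zero] at this
    nlinarith
  choose M hM using hbd
  have hcl : IsCompact ({z : Ambient n × ℝ |
      0 ≤ z.2 ∧ z.1 ∈ surface Ω u z.2 ∧ lev - a ≤ z.1.snd} ∩ {z | z.2 ≤ T ∧ m ≤ z.1.snd}) := by
    refine Metric.isCompact_of_isClosed_isBounded (hclosed.inter
      ((isClosed_le continuous_snd continuous_const).inter
        (isClosed_le continuous_const (continuous_snd_ambient.comp continuous_fst)))) ?_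
    obtain ⟨A, hA⟩ := ((Finset.range (⌊T⌋₊ + 1)).image M).bddAbove
    have hA' : ∀ z ∈ {z : Ambient n × ℝ |
      0 ≤ z.2 ∧ z.1 ∈ surface Ω u z.2 ∧ lev - a ≤ z.1.snd} ∩ {z | z.2 ≤ T ∧ m ≤ z.1.snd},
        ‖z.1.fst‖ ≤ A ∧ z.1.snd ≤ A := by
      rintro ⟨p, t⟩ ⟨⟨h0, ⟨h1, h1'⟩, -⟩, h2, h3⟩
      simp only at h0 h1 h1' h2 h3
      have hk := hM ⌊t⌋₊ p.fst t h1 (Nat.floor_le h0) (Nat.lt_floor_add_one t).le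
        (by rw [← h1']; linarith)
      have hle : M ⌊t⌋₊ ≤ A := hA (by
        simp only [Finset.coe_image, Set.mem_image]
        exact ⟨_, by simpa using Nat.lt_succ_of_le (Nat.floor_le_floor h2), rfl⟩)
      rw [← h1'] at hk
      exact ⟨hk.1.trans hle, hk.2.trans hle⟩
    refine ((Metric.isBounded_closedBall (x := (0 : Ambient n)) (r := A + (|A| + |m|))).prod
      (Metric.isBounded_Icc 0 T)).subset ?_
    rintro ⟨p, t⟩ hz
    obtain ⟨h1, h2⟩ := hA' _ hz
    refine ⟨?_, hz.1.1, hz.2.1⟩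
    have h3 : m ≤ p.snd := hz.2.2
    simp only at h1 h2
    have hA0 : 0 ≤ A := (norm_nonneg _).trans h1
    rw [mem_closedBall_zero_iff]
    refine abs_le_of_sq_le_sq' ?_ (by positivity) |>.2
    rw [WithLp.prod_norm_sq_eq_of_L2, Real.norm_eq_abs, sq_abs]
    have h4 : |p.snd| ≤ |A| + |m| :=
      abs_le.2 ⟨by linarith [neg_abs_le m, abs_nonneg A], by linarith [le_abs_self A, abs_nonneg m]⟩
    have h5 : ‖p.fst‖ ^ 2 ≤ A ^ 2 := pow_le_pow_left₀ (norm_nonneg _) h1 2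
    have h6 : p.snd ^ 2 ≤ (|A| + |m|) ^ 2 := sq_le_sq' (abs_le.1 h4).1 (abs_le.1 h4).2
    have h7 : 0 ≤ A * (|A| + |m|) := by positivity
    simp only [WithLp.fst, WithLp.snd] at *
    nlinarith
  have := hcl.image (f := fun z : Ambient n × ℝ => (z.1.fst, z.2))
      ((continuous_fst_ambient.comp continuous_fst).prodMk continuous_snd)
  convert this using 1
  ext ⟨x, t⟩
  constructor
  · rintro ⟨h1, h2, h3⟩
    exact ⟨(point x (u x t), t), ⟨⟨h.nonneg_time h1, ⟨h1, rfl⟩,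
      by simp only [point_snd]; simp only at h3; linarith⟩, h2, h3⟩, rfl⟩
  · rintro ⟨⟨p, s⟩, ⟨⟨-, ⟨h1, h1'⟩, -⟩, h2, h3⟩, he⟩
    simp only [Prod.mk.injEq] at he
    obtain ⟨rfl, rfl⟩ := he
    exact ⟨h1, h2, by simpa only [← h1'] using h3⟩

end Flow

/-! ### Height bounds -/

theorem gradient_fun_const_eq_zero {n : ℕ} (c : ℝ) (x : Base n) :
    gradient (fun _ : Base n => c) x = 0 := by
  simp [gradient]

theorem meanCurvature_const {n : ℕ} (c : ℝ) (x : Base n) :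
    meanCurvature (fun _ : Base n => c) x = 0 := by
  simp [meanCurvature, divergence]

section Flow

variable {n : ℕ} {P : Set (Base n)} {ψ : Base n → ℝ} {β : ℝ → ℝ} {ε : ℝ}
  {Ω : Set (Base n × ℝ)} {u : Base n → ℝ → ℝ}

/-- Contact with a static graph from above. -/
theorem IsPenalisedFlow.contact_above (h : IsPenalisedFlow P ψ β ε Ω u) {x : Base n} {t δ : ℝ}
    {g : Base n → ℝ} (hz : (x, t) ∈ Ω) (ht : 0 < t) (hg : ContDiffAt ℝ 2 g x)
    (hmin : ∀ᶠ z in 𝓝 (x, t), z.2 ≤ t → u x t - g x + δ * t ≤ u z.1 z.2 - g z.1 + δ * z.2) :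
    Real.sqrt (1 + ‖gradient g x‖ ^ 2) *
      (-meanCurvature g x + penalisation β ε (obstacle P ψ) (point x (u x t))) ≤ -δ := by
  have hc : Tendsto (fun y : Base n => (y, t)) (𝓝 x) (𝓝 (x, t)) :=
    (Continuous.prodMk continuous_id continuous_const).tendsto x
  have hc' : Tendsto (fun s : ℝ => (x, s)) (𝓝 t) (𝓝 (x, t)) :=
    (Continuous.prodMk continuous_const continuous_id).tendsto t
  have h1 := meanCurvature_le_of_isLocalMin
    ((h.contDiffAt_slice hz ht).of_le (by norm_cast)) hg (by
      filter_upwards [hc.eventually hmin] with y hy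
      have := hy le_rfl
      linarith)
  have h2 := h.hasDerivAt_time hz ht
  have h3 := (h2.fun_add ((hasDerivAt_id t).const_mul δ)).fun_neg
  have h4 := deriv_nonneg_of_left_max h3 (by
    filter_upwards [hc'.eventually hmin] with s hs hle
    have := hs hle
    simp only [id] at this ⊢
    linarith)
  rw [h1.1] at h4
  have h5 : Real.sqrt (1 + ‖gradient g x‖ ^ 2) * (-meanCurvature g x +
      penalisation β ε (obstacle P ψ) (point x (u x t))) ≤
      Real.sqrt (1 + ‖gradient g x‖ ^ 2) * (-meanCurvature (fun y => u y t) x +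
      penalisation β ε (obstacle P ψ) (point x (u x t))) :=
    mul_le_mul_of_nonneg_left (by linarith [h1.2]) (Real.sqrt_nonneg _)
  linarith

/-- Contact with a rising horizontal plane from below. -/
theorem IsPenalisedFlow.contact_plane_below (h : IsPenalisedFlow P ψ β ε Ω u) {x : Base n}
    {t δ : ℝ} (hz : (x, t) ∈ Ω) (ht : 0 < t)
    (hmax : ∀ᶠ z in 𝓝 (x, t), z.2 ≤ t → u z.1 z.2 - δ * z.2 ≤ u x t - δ * t) :
    δ ≤ penalisation β ε (obstacle P ψ) (point x (u x t)) := by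
  have hc : Tendsto (fun y : Base n => (y, t)) (𝓝 x) (𝓝 (x, t)) :=
    (Continuous.prodMk continuous_id continuous_const).tendsto x
  have hc' : Tendsto (fun s : ℝ => (x, s)) (𝓝 t) (𝓝 (x, t)) :=
    (Continuous.prodMk continuous_const continuous_id).tendsto t
  have h1 := meanCurvature_le_of_isLocalMin (f := fun _ : Base n => (0 : ℝ)) contDiffAt_const
    ((h.contDiffAt_slice hz ht).of_le (by norm_cast)) (by
      filter_upwards [hc.eventually hmax] with y hy
      have := hy le_rfl
      linarith)
  rw [gradient_fun_const_eq_zero, meanCurvature_const] at h1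
  have h2 := h.hasDerivAt_time hz ht
  have h3 := h2.fun_sub ((hasDerivAt_id t).const_mul δ)
  have h4 := deriv_nonneg_of_left_max h3 (by
    filter_upwards [hc'.eventually hmax] with s hs hle
    simpa using hs hle)
  rw [← h1.1] at h4
  simp at h4
  linarith [h1.2]

/-- The penalisation only pushes upwards, so no horizontal plane below level `L` can be a first
contact from below. -/
theorem IsPenalisedFlow.le_height (h : IsPenalisedFlow P ψ β ε Ω u) (hβ : IsPenaltyProfile β)
    {L : ℝ} (hL : IsTruncatedAt P ψ L Ω u) {x : Base n} {t : ℝ} (hz : (x, t) ∈ Ω) :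
    L ≤ u x t := by
  by_contra! hlt
  -- A level strictly between the supposed value and `L`: the sublevel set at `c` is compact, and a
  -- small `δ` keeps the minimiser of `u + δ t` strictly below `c`, so the minimum is local in `Ω`
  -- among times up to its own.
  set c := (u x t + L) / 2 with hc
  have ht : 0 ≤ t := h.nonneg_time hz
  obtain ⟨δ, hδ, hδt⟩ : ∃ δ > 0, u x t + δ * t < c := by
    refine ⟨(L - u x t) / (4 * (t + 1)), by apply div_pos <;> linarith, ?_⟩
    have : (L - u x t) / (4 * (t + 1)) * t ≤ (L - u x t) / 4 := by
      rw [div_mul_eq_mul_div, div_le_div_iff₀ (by positivity) (by positivity)]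
      nlinarith
    linarith
  have hS := hL.boundary t c (by linarith)
  have hcont : ContinuousOn (fun z : Base n × ℝ => u z.1 z.2 + δ * z.2)
      {z ∈ Ω | z.2 ≤ t ∧ u z.1 z.2 ≤ c} :=
    (h.continuousOn.mono fun z hz => hz.1).add (by fun_prop)
  have hmem : (x, t) ∈ {z ∈ Ω | z.2 ≤ t ∧ u z.1 z.2 ≤ c} := ⟨hz, le_rfl, by simp only; linarith⟩
  obtain ⟨⟨y, s⟩, ⟨hy, hst, -⟩, hmin⟩ := hS.exists_isMinOn ⟨_, hmem⟩ hcont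
  have hval := hmin hmem
  have hs0 : 0 ≤ s := h.nonneg_time hy
  simp only [Set.mem_ofPred_eq] at hval hst
  have hlow : u y s < c := by nlinarith
  have hs : 0 < s := by
    refine lt_of_le_of_ne hs0 fun he => ?_
    subst he
    have := hL.initial (point y (u y 0)) ⟨hy, rfl⟩
    simp only [point_snd] at this
    linarith
  have hev : ∀ᶠ z in 𝓝 (y, s), z.2 ≤ s → u y s - (0 : ℝ) + δ * s ≤ u z.1 z.2 - 0 + δ * z.2 := by
    have hΩ := h.mem_nhds hy hs
    filter_upwards [hΩ, (h.continuousOn.continuousAt hΩ).eventually (gt_mem_nhds hlow)]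
      with z h1 h2 h3
    simpa using hmin (show z ∈ _ from ⟨h1, h3.trans hst, h2.le⟩)
  have := h.contact_above hy hs (g := fun _ => 0) contDiffAt_const hev
  rw [gradient_fun_const_eq_zero, meanCurvature_const] at this
  have h0 := penalisation_nonneg (ε := ε) hβ (obstacle P ψ) (point y (u y s))
  simp at this
  linarith

theorem IsTruncatedAt.le_initial {L : ℝ} (hL : IsTruncatedAt P ψ L Ω u) {x : Base n} (hx : x ∈ P)
    (hz : (x, (0 : ℝ)) ∈ Ω) : ψ x ≤ u x 0 := by
  by_contra! hlt
  exact Set.disjoint_left.1 hL.disjoint (show point x (u x 0) ∈ _ from ⟨hz, rfl⟩) ⟨hx, hlt⟩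

theorem bddAbove_initial {ℓ : ℝ} (hcomp : IsCompact {p ∈ surface Ω u 0 | ℓ ≤ p.snd}) :
    BddAbove ((fun q : Ambient n => q.snd) '' surface Ω u 0) := by
  obtain ⟨A, hA⟩ := (hcomp.image continuous_snd_ambient).bddAbove
  refine ⟨max A ℓ, ?_⟩
  rintro _ ⟨q, hq, rfl⟩
  rcases le_total ℓ q.snd with h1 | h1
  · exact (hA ⟨q, ⟨hq, h1⟩, rfl⟩).trans (le_max_left _ _)
  · exact h1.trans (le_max_right _ _)

/-- At a positive-time maximum of `u - δ t` the penalisation must be active, so the point lies in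
the obstacle. But over the same base point the initial surface lies above `ψ`, hence higher,
contradicting maximality. -/
theorem IsPenalisedFlow.height_le_sSup (h : IsPenalisedFlow P ψ β ε Ω u) (hψ : IsObstacle P ψ)
    (hβ : IsPenaltyProfile β) (hε : 0 < ε) {L ℓ : ℝ} (hL : IsTruncatedAt P ψ L Ω u)
    (hK : IsCompactAbove ℓ Ω u) {x : Base n} {t : ℝ} (hz : (x, t) ∈ Ω) (hℓ : ℓ ≤ u x t) :
    u x t ≤ sSup ((fun q : Ambient n => q.snd) '' surface Ω u 0) := by
  obtain ⟨a, ha, hclosed, hcomp⟩ := hK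
  have hbdd := bddAbove_initial (hcomp 0 le_rfl)
  have ht : 0 ≤ t := h.nonneg_time hz
  have key : ∀ δ : ℝ, 0 < δ → δ * t < a / 2 →
      u x t - δ * t ≤ sSup ((fun q : Ambient n => q.snd) '' surface Ω u 0) := by
    intro δ hδ hδt
    have hS := h.isCompact_track hψ hβ hε ha hclosed hcomp t (m := ℓ - a / 2) le_rfl
    set S := {z ∈ Ω | z.2 ≤ t ∧ ℓ - a / 2 ≤ u z.1 z.2} with hSdef
    have hcont : ContinuousOn (fun z : Base n × ℝ => u z.1 z.2 - δ * z.2) S :=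
      (h.continuousOn.mono fun z hz => hz.1).sub (by fun_prop)
    have hmem : (x, t) ∈ S := ⟨hz, le_rfl, by simp only; linarith⟩
    obtain ⟨⟨y, s⟩, ⟨hy, hst, hys⟩, hmax⟩ := hS.exists_isMaxOn ⟨_, hmem⟩ hcont
    have hval := hmax hmem
    have hs0 : 0 ≤ s := h.nonneg_time hy
    simp only [Set.mem_ofPred_eq] at hval hst hys
    have hlow : ℓ - a / 2 < u y s := by nlinarith
    rcases hs0.eq_or_lt with he | hs
    · subst he
      have := le_csSup hbdd ⟨point y (u y 0), ⟨hy, rfl⟩, rfl⟩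
      simp only [point_snd] at this
      linarith
    · exfalso
      have hev : ∀ᶠ z in 𝓝 (y, s), z.2 ≤ s → u z.1 z.2 - δ * z.2 ≤ u y s - δ * s := by
        have hΩ := h.mem_nhds hy hs
        filter_upwards [hΩ, (h.continuousOn.continuousAt hΩ).eventually (lt_mem_nhds hlow)]
          with z h1 h2 h3
        exact hmax (show z ∈ S from ⟨h1, h3.trans hst, h2.le⟩)
      have hα := h.contact_plane_below hy hs hev
      have hO : point y (u y s) ∈ obstacle P ψ := by
        by_contra hO
        rw [penalisation_eq_zero hβ hε hO] at hα
        linarith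
      obtain ⟨hP, hlt⟩ := hO
      simp only [point_fst, point_snd] at hP hlt
      -- The lower height bound gives `L ≤ ψ y`, which puts `y` in the initial domain as well.
      have h0 := hL.covers y hP ((h.le_height hβ hL hy).trans hlt.le) 0 le_rfl
      have h1 := hL.le_initial hP h0
      have h2 := hmax (show (y, (0 : ℝ)) ∈ S from ⟨h0, ht, by simp only; linarith⟩)
      simp only [Set.mem_ofPred_eq] at h2
      nlinarith
  refine le_of_forall_pos_sub_le fun η hη => ?_
  obtain ⟨δ, hδ, h1, h2⟩ : ∃ δ > 0, δ * t < a / 2 ∧ δ * t ≤ η := by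
    have hpos : 0 < min (a / 4) η := by positivity
    refine ⟨min (a / 4) η / (t + 1), by positivity, ?_⟩
    have : min (a / 4) η / (t + 1) * t ≤ min (a / 4) η := by
      rw [div_mul_eq_mul_div, div_le_iff₀ (by positivity)]
      nlinarith
    exact ⟨by linarith [min_le_left (a / 4) η], this.trans (min_le_right _ _)⟩
  linarith [key δ hδ h1]

/-! ### The signed distance and the penalisation -/

theorem infDist_frontier_le_dist {A : Set (Ambient n)} {p q : Ambient n} (hp : p ∈ A)
    (hq : q ∉ A) : Metric.infDist p (frontier A) ≤ dist p q := by
  obtain ⟨y, hy, he⟩ := exists_mem_frontier_infDist_compl_eq_dist hp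
    (fun h => hq (by rw [h]; trivial))
  calc Metric.infDist p (frontier A) ≤ dist p y := Metric.infDist_le_dist_of_mem hy
    _ = Metric.infDist p Aᶜ := he.symm
    _ ≤ dist p q := Metric.infDist_le_dist_of_mem hq

theorem signedDistBdry_of_mem {A : Set (Ambient n)} {p : Ambient n} (hp : p ∈ A) :
    signedDistBdry A p = -Metric.infDist p (frontier A) := if_pos hp

theorem inner_gradient_ambient {f : Ambient n → ℝ} (x v : Ambient n) :
    inner ℝ (gradient f x) v = fderiv ℝ f x v := by
  simp [gradient]

/-- This includes boundary points, where nothing is known about the distance function. The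
penalisation at `q` is at most `β (-‖q - p‖ / ε)`, which is `o(‖q - p‖)` because `β` and its
derivative vanish at `0`. -/
theorem hasFDerivAt_penalisation_of_notMem (hβ : IsPenaltyProfile β) (hε : 0 < ε)
    {A : Set (Ambient n)} {p : Ambient n} (hp : p ∉ A) :
    HasFDerivAt (penalisation β ε A) (0 : Ambient n →L[ℝ] ℝ) p := by
  have h1 : HasDerivAt (fun r : ℝ => β (-r / ε)) 0 0 := by
    have hb : HasDerivAt β (deriv β (-0 / ε)) (-0 / ε) := (hβ.differentiable _).hasDerivAt
    have := hb.comp (0 : ℝ) (((hasDerivAt_id (0 : ℝ)).fun_neg).div_const ε)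
    rw [neg_zero, zero_div, hβ.deriv_eq_zero le_rfl, zero_mul] at this
    exact this
  rw [hasFDerivAt_iff_isLittleO]
  rw [hasDerivAt_iff_isLittleO] at h1
  have ht : Tendsto (fun q : Ambient n => ‖q - p‖) (𝓝 p) (𝓝 0) := by
    have : Continuous fun q : Ambient n => ‖q - p‖ := by fun_prop
    simpa using this.tendsto p
  have h2 := h1.comp_tendsto ht
  refine Asymptotics.IsBigO.trans_isLittleO (g := fun q => β (-‖q - p‖ / ε))
    (Asymptotics.IsBigO.of_bound 1 (Eventually.of_forall fun q => ?_))
    (Asymptotics.IsLittleO.of_norm_right ?_)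
  · rw [penalisation_eq_zero hβ hε hp]
    simp only [sub_zero, zero_apply, one_mul, Real.norm_eq_abs]
    rw [abs_of_nonneg (penalisation_nonneg hβ _ _), abs_of_nonneg (hβ.nonneg _)]
    by_cases hq : q ∈ A
    · unfold penalisation
      apply hβ.antitone_self
      rw [signedDistBdry_of_mem hq]
      have := infDist_frontier_le_dist hq hp
      rw [dist_eq_norm] at this
      gcongr
    · rw [penalisation_eq_zero hβ hε hq]
      exact hβ.nonneg _
  · refine h2.congr (fun q => ?_) (fun q => ?_)
    · simp [hβ.eq_zero le_rfl]
    · simp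

theorem norm_gradient_signedDistBdry_le {A : Set (Ambient n)} (hA : IsOpen A) {p : Ambient n}
    (hp : p ∈ A) (hd : DifferentiableAt ℝ (signedDistBdry A) p) :
    ‖gradient (signedDistBdry A) p‖ ≤ 1 := by
  have h1 : ‖fderiv ℝ (signedDistBdry A) p‖ ≤ 1 := by
    refine hd.hasFDerivAt.le_of_lip' zero_le_one ?_
    filter_upwards [hA.mem_nhds hp] with q hq
    rw [signedDistBdry_of_mem hp, signedDistBdry_of_mem hq, Real.norm_eq_abs, one_mul,
      ← dist_eq_norm, neg_sub_neg, ← Real.dist_eq, dist_comm q p]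
    simpa using (Metric.lipschitz_infDist_pt (frontier A)).dist_le_mul p q
  simpa [gradient] using h1

theorem hasDerivAt_line (x e : Base n) (s : ℝ) : HasDerivAt (fun s : ℝ => x + s • e) e s := by
  simpa using ((hasDerivAt_id s).smul_const e).const_add x

theorem hasDerivAt_comp_graph_curve {f : Base n → ℝ} {x : Base n} (hf : DifferentiableAt ℝ f x)
    (e : Base n) {A : Ambient n → ℝ} {A' : Ambient n →L[ℝ] ℝ}
    (hA : HasFDerivAt A A' (point x (f x))) :
    HasDerivAt (fun s : ℝ => A (point (x + s • e) (f (x + s • e))))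
      (A' (point e (fderiv ℝ f x e))) 0 := by
  have hx0 : x + (0 : ℝ) • e = x := by simp
  have hul : HasDerivAt (fun s : ℝ => f (x + s • e)) (fderiv ℝ f x e) 0 := by
    have hud : HasFDerivAt f (fderiv ℝ f x) (x + (0 : ℝ) • e) := by
      rw [hx0]; exact hf.hasFDerivAt
    exact hud.comp_hasDerivAt 0 (hasDerivAt_line x e 0)
  have h1 := (hasDerivAt_line x e 0).prodMk hul
  have h2 : HasFDerivAt (fun z : Base n × ℝ => A (point z.1 z.2))
      (A'.comp (((WithLp.prodContinuousLinearEquiv 2 ℝ (Base n) ℝ).symm).toContinuousLinearMap))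
      (x + (0 : ℝ) • e, f (x + (0 : ℝ) • e)) := by
    rw [hx0]
    exact HasFDerivAt.comp (x, f x) (g := A)
      (f := ((WithLp.prodContinuousLinearEquiv 2 ℝ (Base n) ℝ).symm).toContinuousLinearMap) hA
      (ContinuousLinearMap.hasFDerivAt _)
  have h3 := h2.comp_hasDerivAt 0 h1
  exact h3

theorem inner_point_smul (w : Ambient n) (e : Base n) (r s : ℝ) :
    inner ℝ w (point (r • e) s) = r * inner ℝ w (point e 0) + s * inner ℝ w (vertical n) := by
  have : point (r • e) s = r • point e 0 + s • vertical n := by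
    simp [point, vertical, ← WithLp.toLp_smul, ← WithLp.toLp_add]
  rw [this, inner_add_right, inner_smul_right, inner_smul_right]

/-- A graph direction steeper than the plane orthogonal to `w` points to the side of `w`. -/
theorem inner_point_nonneg {w : Ambient n} (hw : ‖w‖ ≤ 1) {e : Base n} (he : ‖e‖ = 1) {p : ℝ}
    (hp : 0 ≤ p) (hc : 0 < inner ℝ w (vertical n))
    (hle : (inner ℝ w (vertical n))⁻¹ ≤ Real.sqrt (1 + p ^ 2)) :
    0 ≤ inner ℝ w (point e p) := by
  have hsplit := inner_point_smul w e
  set c := inner ℝ w (vertical n) with hcdef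
  set b := inner ℝ w (point e 0) with hbdef
  have hcK : 1 ≤ c ^ 2 * (1 + p ^ 2) := by
    rw [Real.le_sqrt (by positivity) (by positivity), inv_pow,
      inv_le_iff_one_le_mul₀ (by positivity)] at hle
    linarith
  -- Bessel's inequality: pair `w` with its projection to the plane spanned by `e` and the vertical.
  -- With `hcK` this gives `|b| ≤ p c`, hence `b + p c ≥ 0`.
  have hbc : b ^ 2 + c ^ 2 ≤ 1 := by
    have h1 := real_inner_le_norm w (point (b • e) c)
    have h2 : ‖point (b • e) c‖ ^ 2 = b ^ 2 + c ^ 2 := by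
      rw [WithLp.prod_norm_sq_eq_of_L2]
      simp [norm_smul, he]
    rw [hsplit, ← sq, ← sq, ← h2] at h1
    have h4 : ‖point (b • e) c‖ ^ 2 ≤ 1 * ‖point (b • e) c‖ :=
      h1.trans (mul_le_mul_of_nonneg_right hw (norm_nonneg _))
    rw [← h2]
    nlinarith [norm_nonneg (point (b • e) c)]
  have h1 : b ^ 2 ≤ (p * c) ^ 2 := by nlinarith
  have h2 := (abs_le_of_sq_le_sq' h1 (by positivity)).1
  have h3 := hsplit 1 p
  rw [one_smul] at h3
  rw [h3]
  linarith

/-- Along a direction of steepest ascent of a graph which is steeper than the obstacle, the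
penalisation does not increase. -/
theorem exists_hasDerivAt_penalisation_nonpos (hψ : IsObstacle P ψ) (hβ : IsPenaltyProfile β)
    (hε : 0 < ε) {f : Base n → ℝ} {x e : Base n} {p : ℝ} (hf : DifferentiableAt ℝ f x)
    (he : ‖e‖ = 1) (hp : 0 ≤ p) (hgrad : gradient f x = p • e)
    (hK : point x (f x) ∈ obstacle P ψ →
      DifferentiableAt ℝ (signedDistBdry (obstacle P ψ)) (point x (f x)) ∧
      0 < inner ℝ (gradient (signedDistBdry (obstacle P ψ)) (point x (f x))) (vertical n) ∧
      (inner ℝ (gradient (signedDistBdry (obstacle P ψ)) (point x (f x))) (vertical n))⁻¹ ≤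
        Real.sqrt (1 + p ^ 2)) :
    ∃ A ≤ 0, HasDerivAt (fun s : ℝ => penalisation β ε (obstacle P ψ)
      (point (x + s • e) (f (x + s • e)))) A 0 := by
  have hup : fderiv ℝ f x e = p := by
    rw [← inner_gradient, hgrad, inner_smul_left, real_inner_self_eq_norm_sq, he]
    simp
  by_cases hO : point x (f x) ∈ obstacle P ψ
  · obtain ⟨hd, hc, hle⟩ := hK hO
    have hpos := inner_point_nonneg
      (norm_gradient_signedDistBdry_le (isOpen_obstacle hψ) hO hd) he hp hc hle
    rw [inner_gradient_ambient] at hpos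
    refine ⟨deriv β (signedDistBdry (obstacle P ψ) (point x (f x)) / ε) *
      (fderiv ℝ (signedDistBdry (obstacle P ψ)) (point x (f x)) (point e p) / ε),
      mul_nonpos_of_nonpos_of_nonneg (hβ.deriv_nonpos _) (div_nonneg hpos hε.le), ?_⟩
    have h2 := hasDerivAt_comp_graph_curve hf e hd.hasFDerivAt
    rw [hup] at h2
    have h4 := (hβ.differentiable
      (signedDistBdry (obstacle P ψ) (point x (f x)) / ε)).hasDerivAt
    refine HasDerivAt.comp (0 : ℝ) (h₂ := β) ?_ (h2.div_const ε)
    simpa using h4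
  · refine ⟨0, le_rfl, ?_⟩
    have := hasDerivAt_comp_graph_curve hf e (hasFDerivAt_penalisation_of_notMem hβ hε hO)
    rwa [zero_apply] at this

end Flow

/-! ### The evolution of the localised gradient at a maximum -/

section Slice

variable {n : ℕ}

theorem tendsto_line (x v : Base n) : Tendsto (fun s : ℝ => x + s • v) (𝓝 0) (𝓝 x) := by
  simpa using (hasDerivAt_line x v 0).continuousAt.tendsto

theorem eventually_hasDerivAt_line {f : Base n → ℝ} {x : Base n} (hf : ContDiffAt ℝ 2 f x)
    (v : Base n) : ∀ᶠ s in 𝓝 (0 : ℝ), HasDerivAt (fun s => f (x + s • v))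
      (fderiv ℝ f (x + s • v) v) s := by
  filter_upwards [(tendsto_line x v).eventually (hf.eventually (by norm_num))] with s hs
  exact (hs.differentiableAt (by norm_num)).hasFDerivAt.comp_hasDerivAt s (hasDerivAt_line x v s)

theorem hasDerivAt_fderiv_line {f : Base n → ℝ} {x : Base n} (hf : ContDiffAt ℝ 2 f x)
    (v w : Base n) : HasDerivAt (fun s : ℝ => fderiv ℝ f (x + s • v) w) (hessian f x v w) 0 := by
  have hd : DifferentiableAt ℝ (fderiv ℝ f) (x + (0 : ℝ) • v) := by
    simpa using (hf.fderiv_right (m := 1) (by norm_num)).differentiableAt (by norm_num)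
  have := hd.hasFDerivAt.comp_hasDerivAt 0 (hasDerivAt_line x v 0)
  have h3 := this.clm_apply (hasDerivAt_const (0 : ℝ) w)
  simpa using h3

theorem hessian_symm {f : Base n → ℝ} {x : Base n} (hf : ContDiffAt ℝ 2 f x) (v w : Base n) :
    hessian f x v w = hessian f x w v :=
  (hf.isSymmSndFDerivAt (by simp)) v w

theorem contDiffAt_fderiv_apply {f : Base n → ℝ} {x : Base n} (hf : ContDiffAt ℝ ∞ f x)
    (e : Base n) : ContDiffAt ℝ ∞ (fun y => fderiv ℝ f y e) x :=
  (hf.fderiv_right (m := ∞) (by simp)).clm_apply contDiffAt_const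

theorem fderiv_fderiv_apply {f : Base n → ℝ} {x : Base n} (hf : ContDiffAt ℝ 2 f x)
    (e v : Base n) : fderiv ℝ (fun y => fderiv ℝ f y e) x v = hessian f x v e := by
  have hd : DifferentiableAt ℝ (fderiv ℝ f) x :=
    (hf.fderiv_right (m := 1) (by norm_num)).differentiableAt (by norm_num)
  rw [(hd.hasFDerivAt.clm_apply (hasFDerivAt_const e x)).fderiv]
  simp

/-- Third derivatives commute. -/
theorem third_deriv_comm {f : Base n → ℝ} {x : Base n} (hf : ContDiffAt ℝ ∞ f x)
    (e v w : Base n) : fderiv ℝ (fderiv ℝ (fderiv ℝ f)) x e v w =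
      hessian (fun y => fderiv ℝ f y e) x v w := by
  have h1 : ContDiffAt ℝ ∞ (fderiv ℝ f) x := hf.fderiv_right (m := ∞) (by simp)
  have h2 : ContDiffAt ℝ ∞ (fderiv ℝ (fderiv ℝ f)) x := h1.fderiv_right (m := ∞) (by simp)
  have hsymm : fderiv ℝ (fderiv ℝ (fderiv ℝ f)) x e v = fderiv ℝ (fderiv ℝ (fderiv ℝ f)) x v e :=
    ((h1.of_le (m := 2) (by norm_cast)).isSymmSndFDerivAt (by simp)) e v
  have hev : fderiv ℝ (fun y => fderiv ℝ f y e) =ᶠ[𝓝 x] fun y => fderiv ℝ (fderiv ℝ f) y e := by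
    filter_upwards [(hf.of_le (m := 2) (by norm_cast)).eventually (by norm_num)] with y hy
    ext w
    rw [fderiv_fderiv_apply hy, hessian_symm hy]
    rfl
  rw [hsymm, hessian_apply, EventuallyEq.fderiv_eq hev]
  have hd : DifferentiableAt ℝ (fderiv ℝ (fderiv ℝ f)) x := h2.differentiableAt (by norm_num)
  rw [(hd.hasFDerivAt.clm_apply (hasFDerivAt_const e x)).fderiv]
  simp

/-- The form `v, w ↦ ⟨e, v⟩ ⟨e, w⟩`. -/
noncomputable def innerProdForm (e : Base n) : LinearMap.BilinForm ℝ (Base n) :=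
  LinearMap.mk₂ ℝ (fun v w => inner ℝ e v * inner ℝ e w)
    (fun a b c => by rw [inner_add_right]; ring)
    (fun r a b => by rw [inner_smul_right]; simp [mul_assoc])
    (fun a b c => by rw [inner_add_right]; ring)
    (fun r a b => by rw [inner_smul_right]; simp; ring)

@[simp] theorem innerProdForm_apply (e v w : Base n) :
    innerProdForm e v w = inner ℝ e v * inner ℝ e w := rfl

theorem trace_innerProdForm (e : Base n) : ∑ i, innerProdForm e
    (EuclideanSpace.single i (1 : ℝ)) (EuclideanSpace.single i (1 : ℝ)) = ‖e‖ ^ 2 := by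
  rw [EuclideanSpace.real_norm_sq_eq]
  refine Finset.sum_congr rfl fun i _ => ?_
  simp [EuclideanSpace.inner_single_right, sq]

/-- The spatial information at a maximum of `(f - ℓ)² √(1 + (∂ₑ f)²)`. -/
theorem trace_le_of_isLocalMax {f : Base n → ℝ} {x e : Base n} {ℓ p : ℝ}
    (hf : ContDiffAt ℝ ∞ f x) (he : ‖e‖ = 1) (hp : 0 < p) (hgrad : gradient f x = p • e)
    (hℓ : ℓ < f x)
    (hmax : IsLocalMax (fun y => 2 * Real.log (f y - ℓ) +
      1 / 2 * Real.log (1 + fderiv ℝ f y e ^ 2)) x) :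
    (∀ v, hessian f x v e = -(2 * (1 + p ^ 2) / (f x - ℓ)) * inner ℝ e v) ∧
    2 / (f x - ℓ) * (∑ i, hessian f x (EuclideanSpace.single i (1 : ℝ))
        (EuclideanSpace.single i (1 : ℝ)) - p ^ 2 * hessian f x e e / (1 + p ^ 2)) +
      p / (1 + p ^ 2) * (∑ i, hessian (fun y => fderiv ℝ f y e) x
        (EuclideanSpace.single i (1 : ℝ)) (EuclideanSpace.single i (1 : ℝ)) -
        p ^ 2 * hessian (fun y => fderiv ℝ f y e) x e e / (1 + p ^ 2)) ≤
      (6 * p ^ 2 - 4) / ((f x - ℓ) ^ 2 * (1 + p ^ 2)) := by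
  set r : Base n → ℝ := fun y => fderiv ℝ f y e with hr
  have hf2 : ContDiffAt ℝ 2 f x := hf.of_le (by norm_cast)
  have hr2 : ContDiffAt ℝ 2 r x := (contDiffAt_fderiv_apply hf e).of_le (by norm_cast)
  have hfd : ∀ v, fderiv ℝ f x v = p * inner ℝ e v := by
    intro v
    rw [← inner_gradient, hgrad, inner_smul_left]
    simp
  have hrx : r x = p := by
    simp [hr, hfd, he]
  have hφ : 0 < f x - ℓ := by linarith
  set φ := f x - ℓ with hφdef
  have hV : 0 < 1 + p ^ 2 := by positivity
  set G : Base n → ℝ := fun y => 2 * Real.log (f y - ℓ) + 1 / 2 * Real.log (1 + r y ^ 2) with hG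
  have hG' : ∀ v, ∀ᶠ s in 𝓝 (0 : ℝ), HasDerivAt (fun s => G (x + s • v))
      (2 * (fderiv ℝ f (x + s • v) v / (f (x + s • v) - ℓ)) +
        r (x + s • v) * fderiv ℝ r (x + s • v) v / (1 + r (x + s • v) ^ 2)) s := by
    intro v
    have hpos : ∀ᶠ y in 𝓝 x, ℓ < f y := hf.continuousAt.eventually (lt_mem_nhds hℓ)
    filter_upwards [eventually_hasDerivAt_line hf2 v, eventually_hasDerivAt_line hr2 v,
      (tendsto_line x v).eventually hpos] with s h1 h2 h3
    have h4 := (((h1.sub_const ℓ).log (sub_pos.2 h3).ne').const_mul 2).fun_add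
      ((((h2.fun_pow 2).const_add 1).log (by positivity)).const_mul (1 / 2))
    refine h4.congr_deriv ?_
    have : (1 + r (x + s • v) ^ 2) ≠ 0 := by positivity
    field_simp
    push_cast
    ring
  have hGmax : ∀ v, IsLocalMax (fun s : ℝ => G (x + s • v)) 0 := by
    intro v
    filter_upwards [(tendsto_line x v).eventually hmax] with s hs
    simpa using hs
  have hcrit : ∀ v, fderiv ℝ r x v = -(2 * (1 + p ^ 2) / φ) * inner ℝ e v := by
    intro v
    have h0 := (hGmax v).hasDerivAt_eq_zero (hG' v).self_of_nhds
    simp only [zero_smul, add_zero, hfd, hrx] at h0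
    rw [← hφdef] at h0
    field_simp at h0 ⊢
    nlinarith
  refine ⟨fun v => by rw [← fderiv_fderiv_apply hf2]; exact hcrit v, ?_⟩
  -- Collects the squared first derivatives in the second derivative of `G`: the height term gives
  -- `-2 p² / φ²`, and the gradient term gives `4 (1 - p²) / φ²` after inserting `hcrit`.
  set κ : ℝ := (4 - 6 * p ^ 2) / φ ^ 2 with hκ
  have hsecond : ∀ v, 0 ≤ (-((2 / φ) • hessian f x + (p / (1 + p ^ 2)) • hessian r x +
      κ • innerProdForm e)) v v := by
    intro v
    have h1 := hasDerivAt_fderiv_line hf2 v v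
    have h2 := hasDerivAt_fderiv_line hr2 v v
    have h3 := (eventually_hasDerivAt_line hf2 v).self_of_nhds
    have h4 := (eventually_hasDerivAt_line hr2 v).self_of_nhds
    have h5 := ((h1.fun_div (h3.sub_const ℓ) (by simpa using hφ.ne')).const_mul 2).fun_add
      ((h4.fun_mul h2).fun_div ((h4.fun_pow 2).const_add 1) (by positivity))
    have h6 := second_deriv_nonpos_of_isLocalMax (hG' v) h5 (hGmax v)
    simp only [zero_smul, add_zero, hfd, hrx, hcrit] at h6
    rw [← hφdef] at h6
    simp only [LinearMap.neg_apply, LinearMap.add_apply, LinearMap.smul_apply, smul_eq_mul,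
      innerProdForm_apply]
    rw [neg_nonneg]
    refine le_trans (le_of_eq ?_) h6
    rw [hκ]
    field_simp
    push_cast
    ring
  have htr := graph_trace_nonneg _ hsecond (gradient f x)
  rw [hgrad] at htr
  have hn : ‖p • e‖ ^ 2 = p ^ 2 := by rw [norm_smul, he]; simp
  simp only [LinearMap.neg_apply, LinearMap.add_apply, LinearMap.smul_apply, smul_eq_mul,
    Finset.sum_neg_distrib, Finset.sum_add_distrib, ← Finset.mul_sum, trace_innerProdForm, he,
    map_smul, hn] at htr
  simp only [innerProdForm_apply, real_inner_self_eq_norm_sq, he] at htr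
  set τ := ∑ i, hessian f x (EuclideanSpace.single i (1 : ℝ)) (EuclideanSpace.single i (1 : ℝ))
  set σ := ∑ i, hessian r x (EuclideanSpace.single i (1 : ℝ)) (EuclideanSpace.single i (1 : ℝ))
  set H := hessian f x e e
  set T := hessian r x e e
  rw [← sub_nonneg]
  refine le_trans htr (le_of_eq ?_)
  rw [hκ]
  field_simp
  ring

/-- The derivative of the graphical mean curvature operator in the direction of the gradient. -/
theorem hasDerivAt_graph_operator {f a : Base n → ℝ} {x e : Base n} {p q A : ℝ}
    (hf : ContDiffAt ℝ ∞ f x) (he : ‖e‖ = 1) (hgrad : gradient f x = p • e)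
    (hq : ∀ v, hessian f x v e = q * inner ℝ e v)
    (ha : HasDerivAt (fun s : ℝ => a (x + s • e)) A 0) :
    HasDerivAt (fun s : ℝ => Real.sqrt (1 + ‖gradient f (x + s • e)‖ ^ 2) *
        (-meanCurvature f (x + s • e) + a (x + s • e)))
      (∑ i, hessian (fun y => fderiv ℝ f y e) x
        (EuclideanSpace.single i (1 : ℝ)) (EuclideanSpace.single i (1 : ℝ)) -
        (p ^ 2 * hessian (fun y => fderiv ℝ f y e) x e e + 2 * p * q ^ 2) / (1 + p ^ 2) +
        2 * p ^ 3 * q ^ 2 / (1 + p ^ 2) ^ 2 + p * q * a x / Real.sqrt (1 + p ^ 2) +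
        Real.sqrt (1 + p ^ 2) * A) 0 := by
  have hf2 : ContDiffAt ℝ 2 f x := hf.of_le (by norm_cast)
  have h1 : ContDiffAt ℝ ∞ (fderiv ℝ f) x := hf.fderiv_right (m := ∞) (by simp)
  have h2 : ContDiffAt ℝ ∞ (fderiv ℝ (fderiv ℝ f)) x := h1.fderiv_right (m := ∞) (by simp)
  have hx0 : x + (0 : ℝ) • e = x := by simp
  have hF2 : HasDerivAt (fun s : ℝ => fderiv ℝ (fderiv ℝ f) (x + s • e))
      (fderiv ℝ (fderiv ℝ (fderiv ℝ f)) x e) 0 := by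
    have := (h2.differentiableAt (by norm_num)).hasFDerivAt
    rw [← hx0] at this
    have := this.comp_hasDerivAt 0 (hasDerivAt_line x e 0)
    rw [hx0] at this
    exact this
  -- By symmetry of the Hessian, `hq` says that `Df` changes only in its own direction along `e`;
  -- hence the derivatives of the metric terms involve only `p` and `q`.
  have hN : HasDerivAt (fun s : ℝ => gradient f (x + s • e)) (q • e) 0 := by
    have := (differentiableAt_gradient hf2).hasFDerivAt
    rw [← hx0] at this
    have := this.comp_hasDerivAt 0 (hasDerivAt_line x e 0)
    rw [hx0] at this
    refine this.congr_deriv ?_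
    refine ext_inner_right ℝ fun w => ?_
    rw [inner_fderiv_gradient hf2, inner_smul_left]
    have h3 := hessian_symm hf2 e w
    rw [hq] at h3
    rw [← hessian_apply, h3]
    simp
  have hV := ((hN.norm_sq).const_add 1)
  simp only [hx0, hgrad, inner_smul_left, inner_smul_right, real_inner_self_eq_norm_sq, he] at hV
  have hn : ‖p • e‖ ^ 2 = p ^ 2 := by rw [norm_smul, he]; simp
  have hV0 : 1 + ‖gradient f (x + (0 : ℝ) • e)‖ ^ 2 = 1 + p ^ 2 := by rw [hx0, hgrad, hn]
  have hVpos : 0 < 1 + p ^ 2 := by positivity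
  have hsq := hV.sqrt (by rw [hV0]; exact hVpos.ne')
  have htr : HasDerivAt (fun s : ℝ => ∑ i, hessian f (x + s • e) (EuclideanSpace.single i (1 : ℝ))
      (EuclideanSpace.single i (1 : ℝ))) (∑ i, hessian (fun y => fderiv ℝ f y e) x
        (EuclideanSpace.single i (1 : ℝ)) (EuclideanSpace.single i (1 : ℝ))) 0 := by
    refine HasDerivAt.fun_sum fun i _ => ?_
    have := (hF2.clm_apply (hasDerivAt_const (0 : ℝ) (EuclideanSpace.single i (1 : ℝ)))).clm_apply
      (hasDerivAt_const (0 : ℝ) (EuclideanSpace.single i (1 : ℝ)))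
    refine this.congr_deriv ?_
    simp [third_deriv_comm hf]
  have hHN : HasDerivAt (fun s : ℝ => hessian f (x + s • e) (gradient f (x + s • e))
      (gradient f (x + s • e)))
      (p ^ 2 * hessian (fun y => fderiv ℝ f y e) x e e + 2 * p * q ^ 2) 0 := by
    have := (hF2.clm_apply hN).clm_apply hN
    refine this.congr_deriv ?_
    have h3 : fderiv ℝ (fderiv ℝ f) x e e = q := by
      have := hq e
      simpa [he] using this
    simp only [hx0, hgrad, add_apply, smul_apply, map_smul, third_deriv_comm hf, smul_eq_mul,
      h3]
    ring
  have hall := (htr.fun_sub (hHN.fun_div hV (by rw [hV0]; exact hVpos.ne'))).fun_add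
    (hsq.fun_mul ha)
  have hHx : hessian f x (p • e) (p • e) = p ^ 2 * q := by
    have := hq e
    simp only [map_smul, LinearMap.smul_apply, smul_eq_mul, this]
    simp [he]
    ring
  refine (hall.congr_of_eventuallyEq ?_).congr_deriv ?_
  · filter_upwards [(tendsto_line x e).eventually (hf2.eventually (by norm_num))] with s hs
    rw [meanCurvature_eq hs, neg_neg, mul_add, mul_inv_cancel_left₀]
    exact (Real.sqrt_pos.2 (by positivity)).ne'
  · simp only [hx0, hgrad, hHx, hn]
    have hs : Real.sqrt (1 + p ^ 2) ≠ 0 := (Real.sqrt_pos.2 hVpos).ne'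
    field_simp
    simp
    ring

end Slice

/-! ### Mixed space-time derivatives and the differential inequality at a maximum. -/

theorem hasDerivAt_mixed_space {n : ℕ} {W : Base n × ℝ → ℝ} {x : Base n} {t : ℝ}
    (hW : ContDiffAt ℝ 2 W (x, t)) (e : Base n) :
    HasDerivAt (fun s : ℝ => fderiv ℝ W (x + s • e, t) (0, 1))
      (fderiv ℝ (fderiv ℝ W) (x, t) (e, 0) (0, 1)) 0 := by
  have hd1 : HasFDerivAt (fderiv ℝ W) (fderiv ℝ (fderiv ℝ W) (x, t)) (x + (0 : ℝ) • e, t) := by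
    rw [zero_smul, add_zero]
    exact ((hW.fderiv_right (m := 1) (by norm_num)).differentiableAt (by norm_num)).hasFDerivAt
  have hline : HasDerivAt (fun s : ℝ => (x + s • e, t)) (e, 0) 0 :=
    (hasDerivAt_line x e 0).prodMk (hasDerivAt_const 0 t)
  have h2 := (hd1.comp_hasDerivAt (f := fun s : ℝ => (x + s • e, t)) 0 hline).clm_apply
    (hasDerivAt_const (0 : ℝ) ((0 : Base n), (1 : ℝ)))
  refine h2.congr_deriv ?_
  simp

theorem hasDerivAt_mixed_time {n : ℕ} {W : Base n × ℝ → ℝ} {x : Base n} {t : ℝ}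
    (hW : ContDiffAt ℝ 2 W (x, t)) (e : Base n) :
    HasDerivAt (fun s : ℝ => fderiv ℝ W (x, s) (e, 0))
      (fderiv ℝ (fderiv ℝ W) (x, t) (e, 0) (0, 1)) t := by
  have hd1 : HasFDerivAt (fderiv ℝ W) (fderiv ℝ (fderiv ℝ W) (x, t)) (x, t) :=
    ((hW.fderiv_right (m := 1) (by norm_num)).differentiableAt (by norm_num)).hasFDerivAt
  have htime : HasDerivAt (fun s : ℝ => (x, s)) ((0 : Base n), (1 : ℝ)) t :=
    (hasDerivAt_const t x).prodMk (hasDerivAt_id t)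
  have h2 := (hd1.comp_hasDerivAt (f := fun s : ℝ => (x, s)) t htime).clm_apply
    (hasDerivAt_const t (e, (0 : ℝ)))
  refine h2.congr_deriv ?_
  have hsymm : fderiv ℝ (fderiv ℝ W) (x, t) (e, 0) (0, 1) =
      fderiv ℝ (fderiv ℝ W) (x, t) (0, 1) (e, 0) := (hW.isSymmSndFDerivAt (by simp)) _ _
  rw [hsymm]
  simp

theorem hasDerivAt_time_slice {n : ℕ} {W : Base n × ℝ → ℝ} {x : Base n} {t : ℝ}
    (hW : ContDiffAt ℝ 2 W (x, t)) :
    HasDerivAt (fun s => W (x, s)) (fderiv ℝ W (x, t) (0, 1)) t :=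
  (hW.differentiableAt (by norm_num)).hasFDerivAt.comp_hasDerivAt (f := fun s : ℝ => (x, s)) t
    ((hasDerivAt_const t x).prodMk (hasDerivAt_id t))

theorem fderiv_space_slice {n : ℕ} {W : Base n × ℝ → ℝ} {x : Base n} {t : ℝ}
    (hW : DifferentiableAt ℝ W (x, t)) (v : Base n) :
    fderiv ℝ W (x, t) (v, 0) = fderiv ℝ (fun y => W (y, t)) x v := by
  have := (HasFDerivAt.comp x (g := W) (f := fun y : Base n => (y, t))
      hW.hasFDerivAt (hasFDerivAt_prodMk_left x t)).fderiv
  rw [show (fun y => W (y, t)) = W ∘ fun y => (y, t) from rfl, this]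
  simp

/-- The unknowns `τ`, `σ`, `T` enter `ht` exactly through the left side of `htr`. After their
removal the terms in `a` combine to `2 a / (φ v)` through `v² = 1 + p²`, and the quadratic terms
through `8 p² - (6 p² - 4) = 2 (p² + 2)`. -/
theorem localised_gradient_algebra {p q v φ τ σ T a A δ : ℝ} (hv : 0 < v) (hφ : 0 < φ)
    (hv2 : v ^ 2 = 1 + p ^ 2) (hq : q = -(2 * (1 + p ^ 2) / φ))
    (htr : 2 / φ * (τ - p ^ 2 * q / (1 + p ^ 2)) + p / (1 + p ^ 2) * (σ - p ^ 2 * T / (1 + p ^ 2))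
      ≤ (6 * p ^ 2 - 4) / (φ ^ 2 * (1 + p ^ 2)))
    (ht : δ ≤ 2 * ((τ - p ^ 2 * q / (1 + p ^ 2) + v * a) / φ) +
      p * (σ - (p ^ 2 * T + 2 * p * q ^ 2) / (1 + p ^ 2) +
        2 * p ^ 3 * q ^ 2 / (1 + p ^ 2) ^ 2 + p * q * a / v + v * A) / (1 + p ^ 2)) :
    δ ≤ 2 * a / (φ * v) - 2 * (p ^ 2 + 2) / (φ ^ 2 * (1 + p ^ 2)) + p / v * A := by
  have hV : 0 < 1 + p ^ 2 := by positivity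
  have e0 : 2 * ((τ - p ^ 2 * q / (1 + p ^ 2) + v * a) / φ) +
      p * (σ - (p ^ 2 * T + 2 * p * q ^ 2) / (1 + p ^ 2) +
        2 * p ^ 3 * q ^ 2 / (1 + p ^ 2) ^ 2 + p * q * a / v + v * A) / (1 + p ^ 2) =
      (2 / φ * (τ - p ^ 2 * q / (1 + p ^ 2)) +
        p / (1 + p ^ 2) * (σ - p ^ 2 * T / (1 + p ^ 2))) +
      (2 * v * a / φ + p * (p * q * a / v) / (1 + p ^ 2)) + p * (v * A) / (1 + p ^ 2) -
      2 * p ^ 2 * q ^ 2 / (1 + p ^ 2) ^ 3 := by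
    field_simp
    ring
  have e1 : 2 * v * a / φ + p * (p * q * a / v) / (1 + p ^ 2) = 2 * a / (φ * v) := by
    rw [hq]
    field_simp
    linear_combination a * hv2
  have e2 : p * (v * A) / (1 + p ^ 2) = p / v * A := by
    rw [← hv2]
    field_simp
  have e3 : 2 * p ^ 2 * q ^ 2 / (1 + p ^ 2) ^ 3 = 8 * p ^ 2 / (φ ^ 2 * (1 + p ^ 2)) := by
    rw [hq]
    field_simp
    ring
  have e4 : 2 * (p ^ 2 + 2) / (φ ^ 2 * (1 + p ^ 2)) =
      8 * p ^ 2 / (φ ^ 2 * (1 + p ^ 2)) - (6 * p ^ 2 - 4) / (φ ^ 2 * (1 + p ^ 2)) := by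
    rw [← sub_div]
    congr 1
    ring
  rw [e0, e1, e2, e3] at ht
  rw [e4]
  linarith

/-- The key differential inequality at a space-time maximum of
`log ((W - ℓ)² √(1 + (∂ₑ W)²)) - δ t`. -/
theorem localised_gradient_maximum {n : ℕ} {W : Base n × ℝ → ℝ} {a : Base n → ℝ} {x e : Base n}
    {t ℓ p A δ : ℝ} (hW : ContDiffAt ℝ ∞ W (x, t)) (he : ‖e‖ = 1) (hp : 0 < p)
    (hgrad : gradient (fun y => W (y, t)) x = p • e) (hℓ : ℓ < W (x, t))
    (hpde : ∀ᶠ y in 𝓝 x, fderiv ℝ W (y, t) (0, 1) =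
      Real.sqrt (1 + ‖gradient (fun y => W (y, t)) y‖ ^ 2) *
        (-meanCurvature (fun y => W (y, t)) y + a y))
    (ha : HasDerivAt (fun s : ℝ => a (x + s • e)) A 0)
    (hmax : ∀ᶠ z in 𝓝 (x, t), z.2 ≤ t →
      2 * Real.log (W z - ℓ) + 1 / 2 * Real.log (1 + fderiv ℝ W z (e, 0) ^ 2) - δ * z.2 ≤
      2 * Real.log (W (x, t) - ℓ) + 1 / 2 * Real.log (1 + fderiv ℝ W (x, t) (e, 0) ^ 2) - δ * t) :
    δ ≤ 2 * a x / ((W (x, t) - ℓ) * Real.sqrt (1 + p ^ 2)) -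
      2 * (p ^ 2 + 2) / ((W (x, t) - ℓ) ^ 2 * (1 + p ^ 2)) + p / Real.sqrt (1 + p ^ 2) * A := by
  have hW2 : ContDiffAt ℝ 2 W (x, t) := hW.of_le (by norm_cast)
  have hf : ContDiffAt ℝ ∞ (fun y => W (y, t)) x := hW.slice
  have hc : Tendsto (fun y : Base n => (y, t)) (𝓝 x) (𝓝 (x, t)) :=
    (Continuous.prodMk continuous_id continuous_const).tendsto x
  have hslice : ∀ᶠ y in 𝓝 x, ∀ v, fderiv ℝ W (y, t) (v, 0) =
      fderiv ℝ (fun y => W (y, t)) y v := by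
    filter_upwards [hc.eventually (hW2.eventually (by norm_num))] with y hy v
    exact fderiv_space_slice (hy.differentiableAt (by norm_num)) v
  have hfW : fderiv ℝ (fun y => W (y, t)) x e = p := by
    rw [← inner_gradient, hgrad, inner_smul_left, real_inner_self_eq_norm_sq, he]
    simp
  have hWe : fderiv ℝ W (x, t) (e, 0) = p := by rw [hslice.self_of_nhds, hfW]
  obtain ⟨hq, htr⟩ := trace_le_of_isLocalMax hf he hp hgrad hℓ (by
    filter_upwards [hc.eventually hmax, hslice] with y hy hs
    have := hy le_rfl
    rw [hs, hslice.self_of_nhds] at this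
    linarith)
  have hop := hasDerivAt_graph_operator hf he hgrad hq ha
  -- The mixed derivative is computed in space from the equation and then used in time, as the rate
  -- of change of `∂ₑ W`.
  have huniq := (hasDerivAt_mixed_space hW2 e).unique
    (hop.congr_of_eventuallyEq ((tendsto_line x e).eventually hpde))
  have hrt := hasDerivAt_mixed_time hW2 e
  have hWt := hasDerivAt_time_slice hW2
  rw [huniq] at hrt
  rw [hpde.self_of_nhds] at hWt
  have hφ : 0 < W (x, t) - ℓ := by linarith
  have hGt := ((((hWt.sub_const ℓ).log hφ.ne').const_mul 2).fun_add
      ((((hrt.fun_pow 2).const_add 1).log (by positivity)).const_mul (1 / 2))).fun_sub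
      ((hasDerivAt_id t).const_mul δ)
  have h4 := deriv_nonneg_of_left_max hGt (by
    have hc' : Tendsto (fun s : ℝ => (x, s)) (𝓝 t) (𝓝 (x, t)) :=
      (Continuous.prodMk continuous_const continuous_id).tendsto t
    filter_upwards [hc'.eventually hmax] with s hs hle
    exact hs hle)
  have hn : ‖p • e‖ ^ 2 = p ^ 2 := by rw [norm_smul, he]; simp
  have hVpos : 0 < 1 + p ^ 2 := by positivity
  have hee := hq e
  rw [real_inner_self_eq_norm_sq, he, one_pow, mul_one] at hee
  rw [hWe, meanCurvature_eq (hf.of_le (by norm_cast)), neg_neg, hgrad, hn, mul_add,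
    mul_inv_cancel_left₀ (Real.sqrt_pos.2 hVpos).ne'] at h4
  simp only [map_smul, LinearMap.smul_apply, smul_eq_mul, hee] at h4
  rw [hee] at htr
  refine localised_gradient_algebra (Real.sqrt_pos.2 hVpos) hφ (Real.sq_sqrt hVpos.le) rfl htr ?_
  refine (sub_nonneg.1 (le_of_le_of_eq h4 ?_))
  push_cast
  ring

/-! ### The gradient estimate -/

theorem log_sq_mul_sqrt_mul_exp {φ V : ℝ} (hφ : 0 < φ) (hV : 0 < V) (c : ℝ) :
    Real.log (φ ^ 2 * Real.sqrt V * Real.exp c) =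
      2 * Real.log φ + 1 / 2 * Real.log V + c := by
  have := Real.sqrt_pos.2 hV
  rw [Real.log_mul (by positivity) (by positivity), Real.log_mul (by positivity) this.ne',
    Real.log_pow, Real.log_sqrt hV.le, Real.log_exp]
  push_cast
  ring

section Flow

variable {n : ℕ} {P : Set (Base n)} {ψ : Base n → ℝ} {β : ℝ → ℝ} {ε : ℝ}
  {Ω : Set (Base n × ℝ)} {u : Base n → ℝ → ℝ}

theorem localisedGradient_eq (ℓ : ℝ) (u : Base n → ℝ → ℝ) (t : ℝ) (p : Ambient n) :
    localisedGradient ℓ u t p =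
      (p.snd - ℓ) ^ 2 * Real.sqrt (1 + ‖gradient (fun y => u y t) p.fst‖ ^ 2) := by
  rw [localisedGradient, gradientFunction_eq]

/-- If `v` exceeded the bound, then `p > 0`, so the direction `e` exists, and `v > v_𝒪` inside the
obstacle, so the penalisation does not increase along `e`. The differential inequality then forces
`v < α (U - ℓ) ≤ K s`. Positivity of `α`, which places the point in the obstacle and makes `K`
available there, is itself a consequence of that inequality. -/
theorem IsPenalisedFlow.gradient_bound_at_maximum (h : IsPenalisedFlow P ψ β ε Ω u)
    (hψ : IsObstacle P ψ) (hβ : IsPenaltyProfile β) (hε : 0 < ε) {ℓ K δ s t : ℝ}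
    (hK : IsObstacleBound P ψ β ε ℓ Ω u K) (hδ : 0 < δ) {x : Base n} (hz : (x, t) ∈ Ω)
    (ht : 0 < t) (hℓ : ℓ < u x t) (hs : u x t - ℓ ≤ s)
    (hmax : ∀ z ∈ Ω, z.2 ≤ t → ℓ ≤ u z.1 z.2 →
      (u z.1 z.2 - ℓ) ^ 2 * Real.sqrt (1 + ‖gradient (fun y => u y z.2) z.1‖ ^ 2) *
        Real.exp (-δ * z.2) ≤
      (u x t - ℓ) ^ 2 * Real.sqrt (1 + ‖gradient (fun y => u y t) x‖ ^ 2) *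
        Real.exp (-δ * t)) :
    Real.sqrt (1 + ‖gradient (fun y => u y t) x‖ ^ 2) ≤ max 1 (max K (s * K)) := by
  have hφ : 0 < u x t - ℓ := by linarith
  by_contra! hlt
  simp only [max_lt_iff] at hlt
  obtain ⟨h1, h2, h3⟩ := hlt
  set p := ‖gradient (fun y => u y t) x‖ with hp
  have hppos : 0 < p := by
    refine lt_of_le_of_ne (norm_nonneg _) fun h0 => ?_
    rw [← h0] at h1
    simp at h1
  set e : Base n := p⁻¹ • gradient (fun y => u y t) x with he
  have hen : ‖e‖ = 1 := by
    rw [he, norm_smul, ← hp, norm_inv, Real.norm_of_nonneg hppos.le, inv_mul_cancel₀ hppos.ne']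
  have hgrad : gradient (fun y => u y t) x = p • e := by
    rw [he, smul_inv_smul₀ hppos.ne']
  have hW := h.contDiffAt hz ht
  have hΩ := h.mem_nhds hz ht
  obtain ⟨A, hA, hAd⟩ := exists_hasDerivAt_penalisation_nonpos hψ hβ hε
    ((h.contDiffAt_slice hz ht).differentiableAt (by norm_num)) hen hppos.le hgrad (fun hO => by
      obtain ⟨hd, hc, hle⟩ := hK t ht.le (point x (u x t)) ⟨⟨hz, rfl⟩, hO⟩ hℓ.le
      exact ⟨hd, hc, by
        linarith [penalisation_nonneg (ε := ε) hβ (obstacle P ψ) (point x (u x t))]⟩)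
  have hpde : ∀ᶠ y in 𝓝 x, fderiv ℝ (fun z : Base n × ℝ => u z.1 z.2) (y, t) (0, 1) =
      Real.sqrt (1 + ‖gradient (fun y => u y t) y‖ ^ 2) *
        (-meanCurvature (fun y => u y t) y +
          penalisation β ε (obstacle P ψ) (point y (u y t))) := by
    filter_upwards [h.slice_mem_nhds hz] with y hy
    exact (hasDerivAt_time_slice ((h.contDiffAt hy ht).of_le (by norm_cast))).unique
      (h.hasDerivAt_time hy ht)
  have key := localised_gradient_maximum (ℓ := ℓ) (δ := δ)
    (a := fun y => penalisation β ε (obstacle P ψ) (point y (u y t))) hW hen hppos hgrad hℓ hpde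
    hAd (by
      have hfx : fderiv ℝ (fun z : Base n × ℝ => u z.1 z.2) (x, t) (e, 0) = p := by
        rw [fderiv_space_slice (hW.differentiableAt (by norm_num)), ← inner_gradient, hgrad,
          inner_smul_left, real_inner_self_eq_norm_sq, hen]
        simp
      rw [hfx]
      -- The modified quantity with `∂ₑu` lies below the true one and agrees with it at the maximum,
      -- so it is maximal there too.
      filter_upwards [eventually_mem_nhds_iff.2 hΩ,
        (hW.continuousAt).eventually (lt_mem_nhds hℓ),
        (hW.of_le (m := 2) (by norm_cast)).eventually (by norm_num)] with z hz1 hz2 hz3 hz4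
      have hzΩ := mem_of_mem_nhds hz1
      have hφz : 0 < u z.1 z.2 - ℓ := by linarith
      have hle : fderiv ℝ (fun z : Base n × ℝ => u z.1 z.2) z (e, 0) ^ 2 ≤
          ‖gradient (fun y => u y z.2) z.1‖ ^ 2 := by
        have := fderiv_space_slice (x := z.1) (t := z.2) (hz3.differentiableAt (by norm_num)) e
        simp only [Prod.mk.eta] at this
        rw [this, ← inner_gradient]
        refine sq_le_sq' ?_ ?_
        · have := neg_le_of_abs_le (abs_real_inner_le_norm (gradient (fun y => u y z.2) z.1) e)
          rwa [hen, mul_one] at this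
        · have := real_inner_le_norm (gradient (fun y => u y z.2) z.1) e
          rwa [hen, mul_one] at this
      have h5 := Real.log_le_log (by positivity) (hmax z hzΩ hz4 hz2.le)
      rw [log_sq_mul_sqrt_mul_exp hφz (by positivity),
        log_sq_mul_sqrt_mul_exp hφ (by positivity)] at h5
      have h6 := Real.log_le_log (by positivity)
        (add_le_add_right hle 1)
      linarith)
  simp only at key
  set v := Real.sqrt (1 + p ^ 2) with hv
  have hvpos : 0 < v := by linarith
  have hv2 : v ^ 2 = 1 + p ^ 2 := Real.sq_sqrt (by positivity)
  set α := penalisation β ε (obstacle P ψ) (point x (u x t)) with hα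
  have hα0 : 0 ≤ α := penalisation_nonneg hβ _ _
  have h4 : p / v * A ≤ 0 := mul_nonpos_of_nonneg_of_nonpos (by positivity) hA
  have h5 : 2 * (p ^ 2 + 2) / ((u x t - ℓ) ^ 2 * (1 + p ^ 2)) < 2 * α / ((u x t - ℓ) * v) := by
    linarith
  rw [← hv2, div_lt_div_iff₀ (by positivity) (by positivity)] at h5
  have h6 : v < α * (u x t - ℓ) := by
    by_contra! hcon
    have h7 : 2 * α * ((u x t - ℓ) ^ 2 * v ^ 2) ≤ 2 * v ^ 2 * ((u x t - ℓ) * v) := by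
      have := mul_le_mul_of_nonneg_left hcon
        (show 0 ≤ 2 * (u x t - ℓ) * v ^ 2 by positivity)
      nlinarith
    have h8 : 2 * v ^ 2 * ((u x t - ℓ) * v) ≤ 2 * (p ^ 2 + 2) * ((u x t - ℓ) * v) :=
      mul_le_mul_of_nonneg_right (by linarith) (by positivity)
    linarith
  have hαpos : 0 < α := by
    by_contra! h0
    nlinarith
  have hO : point x (u x t) ∈ obstacle P ψ := by
    by_contra hO
    exact hαpos.ne' (penalisation_eq_zero hβ hε hO)
  obtain ⟨hd, hc, hle⟩ := hK t ht.le (point x (u x t)) ⟨⟨hz, rfl⟩, hO⟩ hℓ.le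
  have hαK : α ≤ K := by linarith [inv_pos.2 hc]
  have h9 : α * (u x t - ℓ) ≤ K * s := mul_le_mul hαK hs hφ.le (hα0.trans hαK)
  linarith

/-- The factor `exp (-δ t)` supplies the strict inequality needed at an interior maximum. A maximum
on the compact track lies at the initial time, at height `ℓ` where the quantity vanishes, or in the
interior. -/
theorem IsPenalisedFlow.gradient_estimate (h : IsPenalisedFlow P ψ β ε Ω u) (hψ : IsObstacle P ψ)
    (hβ : IsPenaltyProfile β) (hε : 0 < ε) {L ℓ K : ℝ} (hL : IsTruncatedAt P ψ L Ω u)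
    (hC : IsCompactAbove ℓ Ω u) (hK : IsObstacleBound P ψ β ε ℓ Ω u K) {x : Base n} {t : ℝ}
    (hz : (x, t) ∈ Ω) (hℓ : ℓ ≤ u x t) :
    (u x t - ℓ) ^ 2 * Real.sqrt (1 + ‖gradient (fun y => u y t) x‖ ^ 2) ≤
      sSup (localisedGradient ℓ u 0 '' {q ∈ surface Ω u 0 | ℓ ≤ q.snd}) +
      (sSup ((fun q : Ambient n => q.snd) '' surface Ω u 0) - ℓ) ^ 2 *
        max 1 (max K ((sSup ((fun q : Ambient n => q.snd) '' surface Ω u 0) - ℓ) * K)) := by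
  set s := sSup ((fun q : Ambient n => q.snd) '' surface Ω u 0) - ℓ with hs
  have hheight : ∀ z ∈ Ω, ℓ ≤ u z.1 z.2 → u z.1 z.2 - ℓ ≤ s := fun z hz hl => by
    have := h.height_le_sSup hψ hβ hε hL hC (x := z.1) (t := z.2) hz hl
    linarith
  have hC' := hC
  obtain ⟨a, ha, hclosed, hcomp⟩ := hC'
  have ht : 0 ≤ t := h.nonneg_time hz
  have hS := h.isCompact_track hψ hβ hε ha hclosed hcomp t (m := ℓ) (by linarith)
  set S := {z ∈ Ω | z.2 ≤ t ∧ ℓ ≤ u z.1 z.2} with hSdef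
  set F : Base n × ℝ → ℝ := fun z =>
    (u z.1 z.2 - ℓ) ^ 2 * Real.sqrt (1 + ‖gradient (fun y => u y z.2) z.1‖ ^ 2) with hF
  have hFc : ContinuousOn F S := by
    have h1 : ContinuousOn (fun z : Base n × ℝ => u z.1 z.2) S :=
      h.continuousOn.mono fun z hz => hz.1
    have h2 : ContinuousOn (fun z : Base n × ℝ => gradient (fun y => u y z.2) z.1) S :=
      h.continuousOn_gradient.mono fun z hz => hz.1
    exact ((h1.sub continuousOn_const).pow 2).mul
      (Real.continuous_sqrt.comp_continuousOn (continuousOn_const.add (h2.norm.pow 2)))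
  have hF0 : ∀ z, 0 ≤ F z := fun z => by positivity
  set M := sSup (localisedGradient ℓ u 0 '' {q ∈ surface Ω u 0 | ℓ ≤ q.snd}) with hM
  have hM0 : 0 ≤ M := by
    refine Real.sSup_nonneg ?_
    rintro _ ⟨q, -, rfl⟩
    rw [localisedGradient_eq]
    positivity
  have hMle : ∀ y, (y, (0 : ℝ)) ∈ Ω → ℓ ≤ u y 0 → F (y, 0) ≤ M := by
    intro y hy hl
    obtain ⟨A, hA⟩ := hS.bddAbove_image hFc
    refine le_csSup ⟨A, ?_⟩ ⟨point y (u y 0), ⟨⟨hy, rfl⟩, hl⟩, localisedGradient_eq _ _ _ _⟩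
    rintro _ ⟨q, ⟨⟨hq1, hq2⟩, hq3⟩, rfl⟩
    rw [localisedGradient_eq, hq2]
    exact hA ⟨(q.fst, 0), ⟨hq1, ht, by simpa only [← hq2] using hq3⟩, rfl⟩
  set C := s ^ 2 * max 1 (max K (s * K)) with hCdef
  have hC0 : 0 ≤ C := mul_nonneg (sq_nonneg _) (zero_le_one.trans (le_max_left _ _))
  have key : ∀ δ : ℝ, 0 < δ → F (x, t) * Real.exp (-δ * t) ≤ M + C := by
    intro δ hδ
    obtain ⟨⟨y, r⟩, ⟨hy, hrt, hyr⟩, hmax⟩ := hS.exists_isMaxOn ⟨(x, t), hz, le_rfl, hℓ⟩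
      (hFc.mul (Continuous.continuousOn (f := fun z : Base n × ℝ => Real.exp (-δ * z.2))
        (by fun_prop)))
    have hval := hmax (show (x, t) ∈ S from ⟨hz, le_rfl, hℓ⟩)
    have hr0 : 0 ≤ r := h.nonneg_time hy
    refine le_trans hval ?_
    simp only at hyr hrt
    have hexp : Real.exp (-δ * r) ≤ 1 := by
      rw [Real.exp_le_one_iff]; nlinarith
    refine le_trans (mul_le_of_le_one_right (hF0 _) hexp) ?_
    rcases hr0.eq_or_lt with he | hr
    · subst he
      linarith [hMle y hy hyr]
    · rcases hyr.eq_or_lt with he | hlt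
      · simp only [hF, ← he]
        simp
        positivity
      · have hb := h.gradient_bound_at_maximum hψ hβ hε hK hδ hy hr hlt (hheight _ hy hyr)
          (fun z hz1 hz2 hz3 => hmax (show z ∈ S from ⟨hz1, hz2.trans hrt, hz3⟩))
        have hu : (u y r - ℓ) ^ 2 ≤ s ^ 2 :=
          pow_le_pow_left₀ (by linarith) (hheight _ hy hyr) 2
        have : F (y, r) ≤ C := mul_le_mul hu hb (Real.sqrt_nonneg _) (sq_nonneg _)
        linarith
  have hlim : Tendsto (fun δ : ℝ => F (x, t) * Real.exp (-δ * t)) (𝓝[>] 0) (𝓝 (F (x, t))) := by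
    have : Continuous fun δ : ℝ => F (x, t) * Real.exp (-δ * t) := by fun_prop
    have h2 := (this.tendsto 0).mono_left (nhdsWithin_le_nhds (s := Set.Ioi (0 : ℝ)))
    simpa using h2
  exact le_of_tendsto hlim (by filter_upwards [self_mem_nhdsWithin] with δ hδ using key δ hδ)

end Flow

/-! ### Differentiability of the distance to a closed set -/

section Distance

/-- By compactness, points of `S` near `p` but outside the ball about the unique nearest point `q`
are farther from `p` by a definite amount `ρ`, which a small displacement of `p` cannot make up. -/
theorem eventually_nearest_close {E : Type*} [PseudoMetricSpace E] [ProperSpace E] {S : Set E} (hS : IsClosed S) {p q : E}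
    (huniq : ∀ q' ∈ S, dist p q' = Metric.infDist p S → q' = q) {η : ℝ} (hη : 0 < η) :
    ∀ᶠ p' in 𝓝 p, ∀ q' ∈ S, dist p' q' = Metric.infDist p' S → dist q' q < η := by
  set r := Metric.infDist p S with hr
  have hC : IsCompact (S ∩ Metric.closedBall p (r + 1) ∩ (Metric.ball q η)ᶜ) :=
    ((isCompact_closedBall p (r + 1)).inter_left hS).inter_right Metric.isOpen_ball.isClosed_compl
  obtain ⟨ρ, hρ, hρC⟩ : ∃ ρ > 0, ∀ q' ∈ S ∩ Metric.closedBall p (r + 1) ∩ (Metric.ball q η)ᶜ,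
      r + ρ ≤ dist p q' := by
    rcases Set.eq_empty_or_nonempty (S ∩ Metric.closedBall p (r + 1) ∩ (Metric.ball q η)ᶜ)
      with he | hne
    · exact ⟨1, one_pos, by simp [he]⟩
    · obtain ⟨q₁, hq₁, hmin⟩ := hC.exists_isMinOn hne
        (Continuous.continuousOn (f := fun q' => dist p q') (by fun_prop))
      have hle : r ≤ dist p q₁ := Metric.infDist_le_dist_of_mem hq₁.1.1
      have hlt : r < dist p q₁ := by
        refine lt_of_le_of_ne hle fun he => hq₁.2 ?_
        rw [huniq q₁ hq₁.1.1 he.symm]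
        exact Metric.mem_ball_self hη
      exact ⟨dist p q₁ - r, by linarith, fun q' hq' => by
        have := hmin hq'
        simp only [Set.mem_ofPred_eq] at this
        linarith⟩
  have hpos : 0 < min 1 ρ / 2 := by positivity
  filter_upwards [Metric.ball_mem_nhds p hpos] with p' hp' q' hq' hd
  rw [Metric.mem_ball] at hp'
  have h1 : Metric.infDist p' S ≤ r + dist p' p := Metric.infDist_le_infDist_add_dist
  have h2 : dist p q' ≤ dist p p' + dist p' q' := dist_triangle _ _ _
  have h3 : dist p q' < r + min 1 ρ := by rw [dist_comm p p'] at h2; linarith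
  by_contra! hcon
  have := hρC q' ⟨⟨hq', by
    rw [Metric.mem_closedBall, dist_comm]; linarith [min_le_left 1 ρ]⟩, by
    simpa using hcon⟩
  linarith [min_le_right 1 ρ]

/-- The squared distance to `q` bounds the function from above; testing `p` against the nearest
point `q'` of `p'` bounds it from below, with error controlled by `‖q' - q‖ ‖p' - p‖`, and `q'`
tends to `q`. -/
theorem hasFDerivAt_infDist_sq {E : Type*} [NormedAddCommGroup E] [InnerProductSpace ℝ E]
    [ProperSpace E] {S : Set E} (hS : IsClosed S) {p q : E} (hq : q ∈ S)
    (hpq : dist p q = Metric.infDist p S)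
    (huniq : ∀ q' ∈ S, dist p q' = Metric.infDist p S → q' = q) :
    HasFDerivAt (fun p' => Metric.infDist p' S ^ 2) ((2 : ℝ) • innerSL ℝ (p - q)) p := by
  rw [hasFDerivAt_iff_isLittleO, Asymptotics.isLittleO_iff]
  intro c hc
  filter_upwards [eventually_nearest_close hS huniq (show 0 < c / 4 by positivity),
    Metric.ball_mem_nhds p (show 0 < c / 2 by positivity)] with p' h1 h2
  obtain ⟨q', hq', hd⟩ := hS.exists_infDist_eq_dist ⟨q, hq⟩ p'
  have h3 := h1 q' hq' hd.symm
  have hval : ∀ z : E, ‖p' - z‖ ^ 2 = ‖p - z‖ ^ 2 + 2 * inner ℝ (p - z) (p' - p) +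
      ‖p' - p‖ ^ 2 := by
    intro z
    rw [show p' - z = (p - z) + (p' - p) by abel, norm_add_sq_real]
  have hup : Metric.infDist p' S ^ 2 ≤ ‖p' - q‖ ^ 2 := by
    rw [← dist_eq_norm]
    exact pow_le_pow_left₀ Metric.infDist_nonneg (Metric.infDist_le_dist_of_mem hq) 2
  have hlow : Metric.infDist p S ^ 2 ≤ ‖p - q'‖ ^ 2 := by
    rw [← dist_eq_norm]
    exact pow_le_pow_left₀ Metric.infDist_nonneg (Metric.infDist_le_dist_of_mem hq') 2
  rw [hval q, ← dist_eq_norm p q, hpq] at hup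
  have he : Metric.infDist p' S ^ 2 = ‖p - q'‖ ^ 2 + 2 * inner ℝ (p - q') (p' - p) +
      ‖p' - p‖ ^ 2 := by rw [← hval, hd, dist_eq_norm]
  have hin : inner ℝ (p - q') (p' - p) = inner ℝ (p - q) (p' - p) - inner ℝ (q' - q) (p' - p) := by
    rw [← inner_sub_left]
    congr 1
    abel
  have hcs := abs_le.1 (abs_real_inner_le_norm (q' - q) (p' - p))
  rw [← dist_eq_norm q' q] at hcs
  have h4 : ‖p' - p‖ < c / 2 := by rwa [← dist_eq_norm]
  have h5 : dist q' q * ‖p' - p‖ ≤ c / 4 * ‖p' - p‖ :=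
    mul_le_mul_of_nonneg_right h3.le (norm_nonneg _)
  have h6 : ‖p' - p‖ ^ 2 ≤ c / 2 * ‖p' - p‖ := by nlinarith [norm_nonneg (p' - p)]
  have h7 : 0 ≤ c * ‖p' - p‖ := by positivity
  have h8 : ((2 : ℝ) • innerSL ℝ (p - q)) (p' - p) = 2 * inner ℝ (p - q) (p' - p) := rfl
  rw [Real.norm_eq_abs, h8, abs_le]
  constructor
  · nlinarith [sq_nonneg ‖p' - p‖]
  · linarith

end Distance

section Obstacle

variable {n : ℕ} {P : Set (Base n)} {ψ : Base n → ℝ}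

theorem IsObstacle.contDiffAt (h : IsObstacle P ψ) {x : Base n} (hx : x ∈ P) :
    ContDiffAt ℝ ∞ ψ x := h.smooth.contDiffAt (h.isOpen.mem_nhds hx)

theorem point_notMem_obstacle {x : Base n} {y : ℝ} (h : ψ x ≤ y) : point x y ∉ obstacle P ψ :=
  fun hm => absurd hm.2 (not_lt.2 h)

/-- Properness excludes boundary points over the edge of `P`: near `q` the base points of the
obstacle stay in a compact superlevel set of `ψ`. -/
theorem IsObstacle.mem_frontier (h : IsObstacle P ψ) {q : Ambient n}
    (hq : q ∈ frontier (obstacle P ψ)) : q.fst ∈ P ∧ q.snd = ψ q.fst := by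
  rw [(isOpen_obstacle h).frontier_eq] at hq
  obtain ⟨hcl, hnot⟩ := hq
  have hP : q.fst ∈ P := by
    have hc := (h.isCompact_superlevel (q.snd - 1)).isClosed
    have hcl2 : IsClosed {q' : Ambient n | q'.fst ∈ {x | x ∈ P ∧ q.snd - 1 ≤ ψ x}} :=
      hc.preimage continuous_fst_ambient
    have hmem : q ∈ closure {q' : Ambient n | q'.fst ∈ {x | x ∈ P ∧ q.snd - 1 ≤ ψ x}} := by
      rw [mem_closure_iff_frequently] at hcl ⊢
      have hev : ∀ᶠ q' : Ambient n in 𝓝 q, q.snd - 1 < q'.snd :=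
        continuous_snd_ambient.continuousAt.eventually (lt_mem_nhds (by linarith))
      refine (hcl.and_eventually hev).mono ?_
      rintro q' ⟨⟨h1, h2⟩, h3⟩
      exact ⟨h1, by linarith⟩
    rw [hcl2.closure_eq] at hmem
    exact hmem.1
  refine ⟨hP, le_antisymm ?_ ?_⟩
  · by_contra! hlt
    have hc : ContinuousAt (fun q : Ambient n => ψ q.fst) q :=
      ContinuousAt.comp (f := fun q : Ambient n => q.fst) (h.contDiffAt hP).continuousAt
        continuous_fst_ambient.continuousAt
    rw [mem_closure_iff_frequently] at hcl
    obtain ⟨q', h1, h2⟩ := (hcl.and_eventually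
      (hc.eventually_lt continuous_snd_ambient.continuousAt hlt)).exists
    exact absurd h1.2 (not_lt.2 h2.le)
  · by_contra! hlt
    exact hnot ⟨hP, hlt⟩

theorem IsObstacle.exists_nearest {p : Ambient n} (hp : p ∈ obstacle P ψ) :
    ∃ q ∈ frontier (obstacle P ψ),
      Metric.infDist p (frontier (obstacle P ψ)) = dist p q := by
  obtain ⟨y, hy, -⟩ := exists_mem_frontier_infDist_compl_eq_dist hp (fun he =>
    point_notMem_obstacle (P := P) (le_refl (ψ p.fst)) (by rw [he]; trivial))
  exact isClosed_frontier.exists_infDist_eq_dist ⟨y, hy⟩ p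

theorem IsObstacle.infDist_pos (h : IsObstacle P ψ) {p : Ambient n} (hp : p ∈ obstacle P ψ) :
    0 < Metric.infDist p (frontier (obstacle P ψ)) := by
  obtain ⟨q, hq, he⟩ := IsObstacle.exists_nearest hp
  rw [he, dist_pos]
  rintro rfl
  rw [(isOpen_obstacle h).frontier_eq] at hq
  exact hq.2 hp

theorem dist_sq_ambient (p q : Ambient n) :
    dist p q ^ 2 = ‖p.fst - q.fst‖ ^ 2 + (p.snd - q.snd) ^ 2 :=
  dist_sq_point p q.fst q.snd

theorem dist_point_point_same (x : Base n) (y y' : ℝ) :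
    dist (point x y) (point x y') = |y - y'| := by
  have := dist_sq_ambient (point x y) (point x y')
  simp only [point_fst, point_snd, sub_self, norm_zero] at this
  rw [← abs_of_nonneg (dist_nonneg (x := point x y) (y := point x y')), ← sq_eq_sq_iff_abs_eq_abs]
  linarith

/-- The depth in the obstacle increases downwards. -/
theorem IsObstacle.infDist_anti (h : IsObstacle P ψ) {x : Base n} {y y' : ℝ} (hx : x ∈ P)
    (hyy : y ≤ y') (hy : y' < ψ x) :
    Metric.infDist (point x y') (frontier (obstacle P ψ)) ≤
      Metric.infDist (point x y) (frontier (obstacle P ψ)) := by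
  obtain ⟨q, hq, he⟩ := IsObstacle.exists_nearest (P := P) (ψ := ψ) (p := point x y)
    ⟨hx, lt_of_le_of_lt hyy hy⟩
  obtain ⟨hq1, hq2⟩ := h.mem_frontier hq
  -- Translate the segment to the foot point upwards: its endpoint leaves the obstacle and its
  -- length is unchanged.
  have h1 : point q.fst (q.snd + (y' - y)) ∉ obstacle P ψ :=
    point_notMem_obstacle (by linarith)
  have h2 := infDist_frontier_le_dist (A := obstacle P ψ) (p := point x y') ⟨hx, hy⟩ h1
  rw [he]
  refine h2.trans (le_of_eq ?_)
  rw [← sq_eq_sq₀ dist_nonneg dist_nonneg, dist_sq_ambient, dist_sq_ambient]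
  simp only [point_fst, point_snd]
  ring

/-- At a nearest boundary point the connecting segment is normal to the boundary. -/
theorem IsObstacle.nearest_eq (h : IsObstacle P ψ) {p q : Ambient n} (hp : p ∈ obstacle P ψ)
    (hq : q ∈ frontier (obstacle P ψ))
    (he : dist p q = Metric.infDist p (frontier (obstacle P ψ))) :
    q.fst ∈ P ∧ p.snd < ψ q.fst ∧
      q - p = Metric.infDist p (frontier (obstacle P ψ)) • graphNormal ψ q.fst := by
  obtain ⟨hq1, hq2⟩ := h.mem_frontier hq
  have hr := h.infDist_pos hp
  rw [← he] at hr ⊢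
  have hψd := ((h.contDiffAt hq1).differentiableAt (by norm_num)).hasFDerivAt
  have hmin : IsLocalMin (fun y => ‖y - p.fst‖ ^ 2 + (ψ y - p.snd) ^ 2) q.fst := by
    refine Eventually.of_forall fun y => ?_
    have h1 := infDist_frontier_le_dist hp (point_notMem_obstacle (P := P) (le_refl (ψ y)))
    rw [← he] at h1
    have h2 := pow_le_pow_left₀ dist_nonneg h1 2
    rw [dist_comm p q, dist_comm p, dist_sq_ambient, dist_sq_ambient, hq2] at h2
    exact h2
  have hcrit := hmin.hasFDerivAt_eq_zero
    ((((hasFDerivAt_id q.fst).sub_const p.fst).norm_sq).add ((hψd.sub_const p.snd).pow 2))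
  set τ := ψ q.fst - p.snd with hτ
  have hfoot : q.fst - p.fst = -τ • gradient ψ q.fst := by
    refine ext_inner_right ℝ fun w => ?_
    have := congrArg (fun L => L w) hcrit
    simp at this
    rw [inner_smul_left, inner_gradient]
    simp only [map_neg, conj_trivial]
    rw [inner_sub_left]
    linarith
  have hdist : dist p q ^ 2 = τ ^ 2 * (1 + ‖gradient ψ q.fst‖ ^ 2) := by
    rw [dist_comm, dist_sq_ambient, hfoot, hq2, norm_smul, norm_neg, mul_pow, Real.norm_eq_abs,
      sq_abs]
    ring
  -- Otherwise the point over `q.fst` at the height of `p` lies outside the obstacle and is no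
  -- farther from `p` than `q`, forcing `τ = 0` and then zero distance.
  have hτpos : 0 < τ := by
    by_contra! hle
    have h1 := infDist_frontier_le_dist hp
      (point_notMem_obstacle (P := P) (show ψ q.fst ≤ p.snd by linarith))
    rw [← he] at h1
    have h2 := pow_le_pow_left₀ dist_nonneg h1 2
    rw [dist_sq_ambient, dist_sq_ambient, hq2] at h2
    simp only [point_fst, point_snd] at h2
    have h3 : τ = 0 := by
      have : τ ^ 2 ≤ 0 := by rw [hτ]; nlinarith
      exact pow_eq_zero_iff (two_ne_zero) |>.1 (le_antisymm this (sq_nonneg _))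
    rw [h3] at hdist
    have : 0 < dist p q ^ 2 := by positivity
    rw [hdist] at this
    simp at this
  refine ⟨hq1, by linarith, ?_⟩
  have hd : dist p q = τ * Real.sqrt (1 + ‖gradient ψ q.fst‖ ^ 2) := by
    rw [← sq_eq_sq₀ dist_nonneg (by positivity), mul_pow, Real.sq_sqrt (by positivity)]
    exact hdist
  have hs : Real.sqrt (1 + ‖gradient ψ q.fst‖ ^ 2) ≠ 0 :=
    (Real.sqrt_pos.2 (by positivity)).ne'
  rw [graphNormal, smul_smul, hd, mul_assoc, mul_inv_cancel₀ hs, mul_one]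
  have h1 : (q - p).fst = (τ • point (-gradient ψ q.fst) 1).fst := by
    rw [show (q - p).fst = q.fst - p.fst from rfl, hfoot]
    simp [point]
  have h2 : (q - p).snd = (τ • point (-gradient ψ q.fst) 1).snd := by
    rw [show (q - p).snd = q.snd - p.snd from rfl, hq2]
    simp [point, hτ]
  rw [← point_fst_snd (q - p), h1, h2]
  rfl

theorem contDiffAt_gradient {f : Base n → ℝ} {x : Base n} (hf : ContDiffAt ℝ ∞ f x) :
    ContDiffAt ℝ ∞ (gradient f) x := by
  rw [contDiffAt_euclidean]
  intro i
  simp only [gradient_apply]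
  exact contDiffAt_fderiv_apply hf _

theorem exists_lipschitzOnWith_of_contDiffAt {F : Type*} [NormedAddCommGroup F] [NormedSpace ℝ F]
    {f : Base n → F} {K : Set (Base n)} (hK : IsCompact K) (hf : ∀ x ∈ K, ContDiffAt ℝ 1 f x) :
    ∃ C, LipschitzOnWith C f K := by
  refine LocallyLipschitzOn.exists_lipschitzOnWith_of_compact hK fun x hx => ?_
  obtain ⟨C, t, ht, hC⟩ := (hf x hx).exists_lipschitzOnWith
  exact ⟨C, t, nhdsWithin_le_nhds ht, hC⟩

theorem norm_point_le (x : Base n) (y : ℝ) : ‖point x y‖ ≤ ‖x‖ + |y| := by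
  refine abs_le_of_sq_le_sq' ?_ (by positivity) |>.2
  rw [WithLp.prod_norm_sq_eq_of_L2]
  simp only [Real.norm_eq_abs, WithLp.fst, WithLp.snd]
  have : 0 ≤ ‖x‖ * |y| := by positivity
  simp only [point]
  nlinarith

/-- The unit normal of the boundary of the obstacle is Lipschitz on compact parts. -/
theorem IsObstacle.exists_lipschitz_normal (h : IsObstacle P ψ) (m : ℝ) : ∃ C : ℝ, 0 < C ∧
    ∀ x ∈ P, m ≤ ψ x → ∀ y ∈ P, m ≤ ψ y →
      ‖graphNormal ψ x - graphNormal ψ y‖ ≤ C * ‖x - y‖ := by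
  have hsq : ∀ x ∈ {x | x ∈ P ∧ m ≤ ψ x},
      ContDiffAt ℝ 1 (fun x => (Real.sqrt (1 + ‖gradient ψ x‖ ^ 2))⁻¹) x := by
    rintro x ⟨hx, -⟩
    have hg := (contDiffAt_gradient (h.contDiffAt hx)).of_le (m := 1) (by norm_cast)
    have hpos : 0 < 1 + ‖gradient ψ x‖ ^ 2 := by positivity
    exact ((contDiffAt_const.add (hg.norm_sq ℝ)).sqrt hpos.ne').inv (Real.sqrt_pos.2 hpos).ne'
  have hN : ∀ x ∈ {x | x ∈ P ∧ m ≤ ψ x}, ContDiffAt ℝ 1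
      (fun x => (Real.sqrt (1 + ‖gradient ψ x‖ ^ 2))⁻¹ • -gradient ψ x) x := by
    intro x hx
    have hg := (contDiffAt_gradient (h.contDiffAt hx.1)).of_le (m := 1) (by norm_cast)
    exact (hsq x hx).smul hg.neg
  obtain ⟨C₁, h₁⟩ := exists_lipschitzOnWith_of_contDiffAt (h.isCompact_superlevel m) hsq
  obtain ⟨C₂, h₂⟩ := exists_lipschitzOnWith_of_contDiffAt (h.isCompact_superlevel m) hN
  refine ⟨C₂ + C₁ + 1, by positivity, fun x hx hmx y hy hmy => ?_⟩
  have e1 : graphNormal ψ x - graphNormal ψ y = point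
      ((Real.sqrt (1 + ‖gradient ψ x‖ ^ 2))⁻¹ • -gradient ψ x -
        (Real.sqrt (1 + ‖gradient ψ y‖ ^ 2))⁻¹ • -gradient ψ y)
      ((Real.sqrt (1 + ‖gradient ψ x‖ ^ 2))⁻¹ - (Real.sqrt (1 + ‖gradient ψ y‖ ^ 2))⁻¹) := by
    simp [graphNormal, point, ← WithLp.toLp_smul, ← WithLp.toLp_sub]
  rw [e1]
  refine (norm_point_le _ _).trans ?_
  have h3 := h₁.dist_le_mul x ⟨hx, hmx⟩ y ⟨hy, hmy⟩
  have h4 := h₂.dist_le_mul x ⟨hx, hmx⟩ y ⟨hy, hmy⟩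
  rw [Real.dist_eq, dist_eq_norm] at h3
  rw [dist_eq_norm, dist_eq_norm] at h4
  nlinarith [norm_nonneg (x - y)]

/-- Two nearest points `q`, `q'` at distance `r` differ by `r` times the difference of their
normals, so `‖q' - q‖ ≤ r C ‖q' - q‖` and they coincide when `r C < 1`. Foot points satisfy `ψ ≥ m`
because they lie over base points where `ψ` exceeds the height of `p`. -/
theorem IsObstacle.hasFDerivAt_signedDistBdry (h : IsObstacle P ψ) {p : Ambient n} {m C : ℝ}
    (hp : p ∈ obstacle P ψ) (hm : m ≤ p.snd)
    (hC : ∀ x ∈ P, m ≤ ψ x → ∀ y ∈ P, m ≤ ψ y →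
      ‖graphNormal ψ x - graphNormal ψ y‖ ≤ C * ‖x - y‖)
    (hclose : Metric.infDist p (frontier (obstacle P ψ)) * C < 1) :
    ∃ y ∈ P, m ≤ ψ y ∧
      HasFDerivAt (signedDistBdry (obstacle P ψ)) (innerSL ℝ (graphNormal ψ y)) p := by
  obtain ⟨q, hq, he⟩ := IsObstacle.exists_nearest hp
  obtain ⟨h1, h2, h3⟩ := h.nearest_eq hp hq he.symm
  have hr := h.infDist_pos hp
  set S := frontier (obstacle P ψ) with hS
  set r := Metric.infDist p S with hrdef
  have huniq : ∀ q' ∈ S, dist p q' = Metric.infDist p S → q' = q := by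
    intro q' hq' he'
    obtain ⟨h1', h2', h3'⟩ := h.nearest_eq hp hq' he'
    have h4 : q' - q = r • (graphNormal ψ q'.fst - graphNormal ψ q.fst) := by
      rw [smul_sub, ← h3, ← h3']
      abel
    have h5 := hC q'.fst h1' (by linarith) q.fst h1 (by linarith)
    have h6 : ‖q'.fst - q.fst‖ ≤ ‖q' - q‖ := by
      refine abs_le_of_sq_le_sq' ?_ (norm_nonneg _) |>.2
      rw [← dist_eq_norm q' q, dist_sq_ambient]
      nlinarith [sq_nonneg (q'.snd - q.snd)]
    have hC0 : 0 ≤ C ∨ C < 0 := le_or_gt 0 C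
    have h7 : ‖q' - q‖ ≤ r * (C * ‖q'.fst - q.fst‖) := by
      rw [h4, norm_smul, Real.norm_of_nonneg hr.le]
      exact mul_le_mul_of_nonneg_left h5 hr.le
    rw [← sub_eq_zero, ← norm_le_zero_iff]
    rcases hC0 with hC0 | hC0
    · have h8 : r * (C * ‖q'.fst - q.fst‖) ≤ r * (C * ‖q' - q‖) := by gcongr
      nlinarith [norm_nonneg (q' - q)]
    · have : r * (C * ‖q'.fst - q.fst‖) ≤ 0 :=
        mul_nonpos_of_nonneg_of_nonpos hr.le
          (mul_nonpos_of_nonpos_of_nonneg hC0.le (norm_nonneg _))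
      linarith
  refine ⟨q.fst, h1, by linarith, ?_⟩
  have hd := (hasFDerivAt_infDist_sq isClosed_frontier hq he.symm huniq).sqrt (by positivity)
  have hloc : signedDistBdry (obstacle P ψ) =ᶠ[𝓝 p]
      fun p' => -Real.sqrt (Metric.infDist p' S ^ 2) := by
    filter_upwards [(isOpen_obstacle h).mem_nhds hp] with p' hp'
    rw [signedDistBdry_of_mem hp', Real.sqrt_sq Metric.infDist_nonneg]
  refine (hd.fun_neg.congr_of_eventuallyEq hloc).congr_fderiv ?_
  rw [← hrdef, Real.sqrt_sq hr.le]
  ext w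
  have h9 : p - q = -(r • graphNormal ψ q.fst) := by rw [← h3]; abel
  rw [h9]
  have h10 : innerSL ℝ (-(r • graphNormal ψ q.fst)) w = -(r * inner ℝ (graphNormal ψ q.fst) w) := by
    rw [innerSL_apply_apply, inner_neg_left, inner_smul_left]
    simp
  simp only [neg_apply, smul_apply, h10, smul_eq_mul, innerSL_apply_apply]
  field_simp

end Obstacle

/-! ### The barrier below the penalised flow -/

/-- The second variable serves as a parameter: with `W (x, ε) = ψ x - ε d (ψ x)` this gives
convergence of the curvature of the barriers to that of `∂𝒪`. -/
theorem continuousAt_meanCurvature_slice {n : ℕ} {W : Base n × ℝ → ℝ} {z₀ : Base n × ℝ}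
    (hW : ContDiffAt ℝ ∞ W z₀) :
    ContinuousAt (fun z : Base n × ℝ => meanCurvature (fun y => W (y, z.2)) z.1) z₀ := by
  have hD1 : ContinuousAt (fderiv ℝ W) z₀ :=
    (hW.fderiv_right (m := ∞) (by simp)).continuousAt
  have hD2 : ContinuousAt (fderiv ℝ (fderiv ℝ W)) z₀ :=
    ((hW.fderiv_right (m := ∞) (by simp)).fderiv_right (m := ∞) (by simp)).continuousAt
  have hev : ∀ᶠ z in 𝓝 z₀, ContDiffAt ℝ 2 W z :=
    (hW.of_le (m := 2) (by norm_cast)).eventually (by norm_num)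
  set g : Base n × ℝ → Base n := fun z => (InnerProductSpace.toDual ℝ (Base n)).symm
      ((fderiv ℝ W z).comp (ContinuousLinearMap.inl ℝ (Base n) ℝ)) with hg
  have hgc : ContinuousAt g z₀ :=
    (LinearIsometryEquiv.continuous _).continuousAt.comp (hD1.clm_comp continuousAt_const)
  have hlift : ∀ {v : Base n × ℝ → Base n}, ContinuousAt v z₀ →
      ContinuousAt (fun z => (v z, (0 : ℝ))) z₀ := fun hv => hv.prodMk continuousAt_const
  have hF : ContinuousAt (fun z => -((Real.sqrt (1 + ‖g z‖ ^ 2))⁻¹ *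
      (∑ i, fderiv ℝ (fderiv ℝ W) z (EuclideanSpace.single i (1 : ℝ), 0)
          (EuclideanSpace.single i (1 : ℝ), 0) -
        fderiv ℝ (fderiv ℝ W) z (g z, 0) (g z, 0) / (1 + ‖g z‖ ^ 2)))) z₀ := by
    have hV : ContinuousAt (fun z => 1 + ‖g z‖ ^ 2) z₀ := continuousAt_const.add (hgc.norm.pow 2)
    have hpos : 0 < 1 + ‖g z₀‖ ^ 2 := by positivity
    refine ((((Real.continuous_sqrt.continuousAt.comp hV).inv₀
      (Real.sqrt_pos.2 hpos).ne').mul ((tendsto_finsetSum _ fun i _ => ?_).sub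
      (((hD2.clm_apply (hlift hgc)).clm_apply (hlift hgc)).div hV hpos.ne')))).neg
    exact (hD2.clm_apply continuousAt_const).clm_apply continuousAt_const
  refine hF.congr ?_
  filter_upwards [hev.eventually_nhds] with z hz
  have hz2 : ContDiffAt ℝ 2 W z := hz.self_of_nhds
  have hslice : ContDiffAt ℝ 2 (fun y => W (y, z.2)) z.1 := hz2.slice
  have hgz : g z = gradient (fun y => W (y, z.2)) z.1 := by
    simp only [hg, gradient]
    congr 1
    ext v
    rw [← fderiv_space_slice (hz2.differentiableAt (by norm_num))]
    simp
  have hc : Tendsto (fun y : Base n => (y, z.2)) (𝓝 z.1) (𝓝 z) :=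
    (Continuous.prodMk continuous_id continuous_const).tendsto z.1
  have hH : ∀ v w, hessian (fun y => W (y, z.2)) z.1 v w =
      fderiv ℝ (fderiv ℝ W) z (v, 0) (w, 0) := by
    intro v w
    rw [← fderiv_fderiv_apply hslice]
    have h1 : (fun y => fderiv ℝ (fun y => W (y, z.2)) y w) =ᶠ[𝓝 z.1]
        fun y => fderiv ℝ W (y, z.2) (w, 0) := by
      filter_upwards [hc.eventually hz] with y hy
      exact (fderiv_space_slice (hy.differentiableAt (by norm_num)) w).symm
    have hd : DifferentiableAt ℝ (fderiv ℝ W) z :=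
      (hz2.fderiv_right (m := 1) (by norm_num)).differentiableAt (by norm_num)
    have h2 := hd.hasFDerivAt.clm_apply (hasFDerivAt_const ((w, 0) : Base n × ℝ) z)
    rw [h1.fderiv_eq, ← fderiv_space_slice (W := fun z => fderiv ℝ W z (w, 0))
      h2.differentiableAt, h2.fderiv]
    simp
  rw [meanCurvature_eq hslice, hgz]
  simp only [hH]

theorem gradient_eq_of_hasFDerivAt {E : Type*} [NormedAddCommGroup E] [InnerProductSpace ℝ E]
    [CompleteSpace E] {f : E → ℝ} {x g : E} (h : HasFDerivAt f (innerSL ℝ g) x) :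
    gradient f x = g :=
  HasGradientAt.gradient (hasGradientAt_iff_hasFDerivAt.2 h)

section Barrier

variable {n : ℕ} {P : Set (Base n)} {ψ : Base n → ℝ} {β : ℝ → ℝ} {ε : ℝ}
  {Ω : Set (Base n × ℝ)} {u : Base n → ℝ → ℝ}

/-- Vertical depth is controlled by distance through a Lipschitz constant of `ψ`. Foot points are
within distance `1` of a point at height at least `m - 1`, hence the superlevel set at `m - 2`. -/
theorem IsObstacle.exists_depth_bound (h : IsObstacle P ψ) (m : ℝ) : ∃ Λ : ℝ, 0 < Λ ∧
    ∀ x ∈ P, m ≤ ψ x → ∀ τ, 0 < τ → τ ≤ 1 →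
      τ ≤ Λ * Metric.infDist (point x (ψ x - τ)) (frontier (obstacle P ψ)) := by
  obtain ⟨C, hC⟩ := exists_lipschitzOnWith_of_contDiffAt (h.isCompact_superlevel (m - 2))
    (fun x hx => (h.contDiffAt hx.1).of_le (m := 1) (by norm_cast))
  refine ⟨C + 1, by positivity, fun x hx hm τ hτ hτ1 => ?_⟩
  have hp : point x (ψ x - τ) ∈ obstacle P ψ := ⟨hx, by simp only [point_fst, point_snd]; linarith⟩
  obtain ⟨q, hq, he⟩ := IsObstacle.exists_nearest hp
  obtain ⟨hq1, hq2⟩ := h.mem_frontier hq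
  have hle := infDist_frontier_le_dist hp (point_notMem_obstacle (P := P) (le_refl (ψ x)))
  rw [dist_point_point_same, abs_sub_comm] at hle
  simp only [sub_sub_cancel, abs_of_pos hτ] at hle
  rw [he] at hle ⊢
  set r := dist (point x (ψ x - τ)) q with hr
  have hr0 : 0 ≤ r := dist_nonneg
  have hd := dist_sq_ambient (point x (ψ x - τ)) q
  rw [← hr] at hd
  simp only [point_fst, point_snd] at hd
  have h1 : ‖x - q.fst‖ ≤ r := by
    refine abs_le_of_sq_le_sq' ?_ hr0 |>.2
    nlinarith [sq_nonneg (ψ x - τ - q.snd)]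
  have h2 := abs_le_of_sq_le_sq' (show (ψ x - τ - q.snd) ^ 2 ≤ r ^ 2 by
    nlinarith [sq_nonneg ‖x - q.fst‖]) hr0
  have h3 := hC.dist_le_mul x ⟨hx, by linarith⟩ q.fst ⟨hq1, by linarith⟩
  rw [Real.dist_eq, dist_eq_norm] at h3
  have h4 : (C : ℝ) * ‖x - q.fst‖ ≤ C * r := mul_le_mul_of_nonneg_left h1 C.2
  have h5 := le_abs_self (ψ x - ψ q.fst)
  nlinarith

/-- The penalisation at depth `ε η` below the boundary beats the mean curvature of the boundary at
height `y`. -/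
def barrierDepths (P : Set (Base n)) (ψ : Base n → ℝ) (β : ℝ → ℝ) (y : ℝ) : Set ℝ :=
  {η | 0 < η ∧ ∀ x ∈ P, ψ x = y → ∀ ε, 0 < ε → ε * η ≤ 1 →
    meanCurvature ψ x + 1 < penalisation β ε (obstacle P ψ) (point x (ψ x - ε * η))}

theorem penalisation_anti (h : IsObstacle P ψ) (hβ : IsPenaltyProfile β) (hε : 0 < ε)
    {x : Base n} {y y' : ℝ} (hx : x ∈ P) (hyy : y ≤ y') (hy : y' < ψ x) :
    penalisation β ε (obstacle P ψ) (point x y') ≤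
      penalisation β ε (obstacle P ψ) (point x y) := by
  unfold penalisation
  apply hβ.antitone_self
  have h1 : point x y' ∈ obstacle P ψ := ⟨hx, hy⟩
  have h2 : point x y ∈ obstacle P ψ := ⟨hx, lt_of_le_of_lt hyy hy⟩
  rw [signedDistBdry_of_mem h1, signedDistBdry_of_mem h2]
  have := h.infDist_anti hx hyy hy
  gcongr

theorem convex_barrierDepths (h : IsObstacle P ψ) (hβ : IsPenaltyProfile β) (y : ℝ) :
    Convex ℝ (barrierDepths P ψ β y) := by
  have hup : IsUpperSet (barrierDepths P ψ β y) := by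
    rintro a b hab ⟨ha, hall⟩
    refine ⟨ha.trans_le hab, fun x hx hxy ε hε hεb => ?_⟩
    have h1 : ε * a ≤ ε * b := mul_le_mul_of_nonneg_left hab hε.le
    refine (hall x hx hxy ε hε (h1.trans hεb)).trans_le ?_
    exact penalisation_anti h hβ hε hx (by linarith) (by linarith [mul_pos hε ha])
  exact hup.ordConnected.convex

/-- Constant depths work locally in the height, by compactness of superlevel sets and unboundedness
of `β`. The admissible depths form a convex set, so a partition of unity glues them smoothly. -/
theorem exists_depth_function (h : IsObstacle P ψ) (hβ : IsPenaltyProfile β) :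
    ∃ d : ℝ → ℝ, ContDiff ℝ ∞ d ∧ ∀ y, d y ∈ barrierDepths P ψ β y := by
  obtain ⟨g, hg⟩ := exists_contMDiffMap_forall_mem_convex_of_local_const (n := (⊤ : ℕ∞))
    (I := modelWithCornersSelf ℝ ℝ) (M := ℝ) (F := ℝ) (convex_barrierDepths h hβ) (fun y₀ => by
      obtain ⟨Λ, hΛ, hdepth⟩ := h.exists_depth_bound (y₀ - 1)
      have hcont : ContinuousOn (meanCurvature ψ) {x | x ∈ P ∧ y₀ - 1 ≤ ψ x} := by
        intro x hx
        have h1 : ContDiffAt ℝ ∞ (fun z : Base n × ℝ => ψ z.1) (x, (0 : ℝ)) :=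
          ContDiffAt.comp (g := ψ) (f := Prod.fst) (x, (0 : ℝ)) (h.contDiffAt hx.1) contDiffAt_fst
        have h2 := continuousAt_meanCurvature_slice h1
        exact (ContinuousAt.comp (f := fun y : Base n => (y, (0 : ℝ))) (x := x) h2
          (by fun_prop)).continuousWithinAt
      obtain ⟨S, hS⟩ := (h.isCompact_superlevel (y₀ - 1)).bddAbove_image hcont
      obtain ⟨s₀, hs₀, hβs⟩ := hβ.exists_lt (S + 1)
      -- Vertical depth `ε Λ s₀` means distance at least `ε s₀`, where the penalisation exceeds `S +
      -- 1`.
      refine ⟨Λ * s₀, ?_⟩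
      filter_upwards [lt_mem_nhds (show y₀ - 1 < y₀ by linarith)] with y hy
      refine ⟨by positivity, fun x hx hxy ε hε hle => ?_⟩
      have hpos : 0 < ε * (Λ * s₀) := by positivity
      have h1 := hdepth x hx (by linarith) (ε * (Λ * s₀)) hpos hle
      have h2 : meanCurvature ψ x ≤ S := hS ⟨x, ⟨hx, by linarith⟩, rfl⟩
      unfold penalisation
      have hmem : point x (ψ x - ε * (Λ * s₀)) ∈ obstacle P ψ :=
        ⟨hx, by simp only [point_fst, point_snd]; linarith⟩
      rw [signedDistBdry_of_mem hmem, neg_div]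
      refine lt_of_le_of_lt (by linarith) (hβs _ ?_)
      rw [le_div_iff₀ hε]
      have h3 : Λ * (s₀ * ε) ≤
          Λ * Metric.infDist (point x (ψ x - ε * (Λ * s₀))) (frontier (obstacle P ψ)) := by
        linarith
      exact le_of_mul_le_mul_left h3 hΛ)
  exact ⟨g, g.contMDiff.contDiff, hg⟩

/-- Smallness of `ε` on the part of the obstacle above the truncation level. -/
theorem eventually_small (h : IsObstacle P ψ) {d : ℝ → ℝ} (hd : ContDiff ℝ ∞ d) (L C : ℝ) :
    ∀ᶠ ε in 𝓝 (0 : ℝ), ∀ x ∈ {x | x ∈ P ∧ L ≤ ψ x}, ε * d (ψ x) < 1 ∧ ε * d (ψ x) * C < 1 ∧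
      meanCurvature (fun y => ψ y - ε * d (ψ y)) x < meanCurvature ψ x + 1 := by
  refine (h.isCompact_superlevel L).eventually_forall_of_forall_eventually fun x hx => ?_
  have hψ := h.contDiffAt hx.1
  have hψ1 : ContDiffAt ℝ ∞ (fun z : ℝ × Base n => ψ z.2) ((0 : ℝ), x) :=
    ContDiffAt.comp (g := ψ) (f := Prod.snd) ((0 : ℝ), x) hψ contDiffAt_snd
  have hψ2 : ContDiffAt ℝ ∞ (fun z : Base n × ℝ => ψ z.1) (x, (0 : ℝ)) :=
    ContDiffAt.comp (g := ψ) (f := Prod.fst) (x, (0 : ℝ)) hψ contDiffAt_fst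
  have hc1 : ContinuousAt (fun z : ℝ × Base n => z.1 * d (ψ z.2)) (0, x) :=
    continuousAt_fst.mul (hd.continuous.continuousAt.comp hψ1.continuousAt)
  have hW : ContDiffAt ℝ ∞ (fun z : Base n × ℝ => ψ z.1 - z.2 * d (ψ z.1)) (x, 0) :=
    hψ2.sub (contDiffAt_snd.mul (hd.contDiffAt.comp (x, (0 : ℝ)) hψ2))
  have hm1 := continuousAt_meanCurvature_slice hW
  have hm2 := continuousAt_meanCurvature_slice hψ2
  have hswap : ContinuousAt (fun z : ℝ × Base n => (z.2, z.1)) ((0 : ℝ), x) := by fun_prop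
  have hc2 : ContinuousAt (fun z : ℝ × Base n =>
      meanCurvature (fun y => ψ y - z.1 * d (ψ y)) z.2) (0, x) :=
    ContinuousAt.comp (f := fun z : ℝ × Base n => (z.2, z.1)) (x := ((0 : ℝ), x)) hm1 hswap
  have hc3 : ContinuousAt (fun z : ℝ × Base n => meanCurvature ψ z.2 + 1) (0, x) :=
    (ContinuousAt.comp (f := fun z : ℝ × Base n => (z.2, z.1)) (x := ((0 : ℝ), x)) hm2
      hswap).add continuousAt_const
  refine (hc1.eventually (gt_mem_nhds (by simp))).and
    (((hc1.mul continuousAt_const).eventually (gt_mem_nhds (by simp))).and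
      (hc2.eventually_lt hc3 (by simp)))

/-- Were the flow to dip below the barrier, then at a contact the penalisation, which grows with
depth, would exceed the barrier's mean curvature and push the flow up. -/
theorem IsPenalisedFlow.barrier_le (hf : IsPenalisedFlow P ψ β ε Ω u) (h : IsObstacle P ψ)
    (hβ : IsPenaltyProfile β) (hε : 0 < ε) {L : ℝ} (hL : IsTruncatedAt P ψ L Ω u) {d : ℝ → ℝ}
    (hd : ContDiff ℝ ∞ d) (hdepth : ∀ y, d y ∈ barrierDepths P ψ β y)
    (hsmall : ∀ x ∈ P, L ≤ ψ x → ε * d (ψ x) < 1 ∧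
      meanCurvature (fun y => ψ y - ε * d (ψ y)) x < meanCurvature ψ x + 1)
    {x : Base n} {t : ℝ} (hx : x ∈ P) (hLx : L ≤ ψ x) (ht : 0 ≤ t) :
    ψ x - ε * d (ψ x) ≤ u x t := by
  set b : Base n → ℝ := fun y => ψ y - ε * d (ψ y) with hb
  have hbd : ∀ y ∈ P, ContDiffAt ℝ ∞ b y := fun y hy =>
    (h.contDiffAt hy).sub (contDiffAt_const.mul (hd.contDiffAt.comp y (h.contDiffAt hy)))
  have hblt : ∀ y, b y < ψ y := fun y => by
    have := mul_pos hε (hdepth (ψ y)).1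
    simp only [hb]
    linarith
  by_contra! hlt
  obtain ⟨δ, hδ, hδt⟩ : ∃ δ > 0, u x t - b x + δ * t < 0 := by
    refine ⟨(b x - u x t) / (2 * (t + 1)), by apply div_pos <;> linarith, ?_⟩
    have : (b x - u x t) / (2 * (t + 1)) * t ≤ (b x - u x t) / 2 := by
      rw [div_mul_eq_mul_div, div_le_div_iff₀ (by positivity) (by positivity)]
      nlinarith
    linarith
  have hsub : {x | x ∈ P ∧ L ≤ ψ x} ×ˢ Set.Icc 0 t ⊆ Ω := by
    rintro ⟨y, s⟩ ⟨⟨hy, hLy⟩, hs⟩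
    exact hL.covers y hy hLy s hs.1
  have hcont : ContinuousOn (fun z : Base n × ℝ => u z.1 z.2 - b z.1 + δ * z.2)
      ({x | x ∈ P ∧ L ≤ ψ x} ×ˢ Set.Icc 0 t) := by
    refine ((hf.continuousOn.mono hsub).sub ?_).add (by fun_prop)
    have : ContinuousOn b {x | x ∈ P ∧ L ≤ ψ x} := fun y hy =>
      (hbd y hy.1).continuousAt.continuousWithinAt
    exact this.comp continuousOn_fst fun z hz => hz.1
  obtain ⟨⟨y, s⟩, ⟨⟨hy, hLy⟩, hs0, hst⟩, hmin⟩ :=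
    ((h.isCompact_superlevel L).prod isCompact_Icc).exists_isMinOn
      ⟨(x, t), ⟨hx, hLx⟩, ht, le_rfl⟩ hcont
  have hval := hmin (show (x, t) ∈ _ from ⟨⟨hx, hLx⟩, ht, le_rfl⟩)
  simp only [Set.mem_ofPred_eq] at hval hs0 hst hy hLy
  have hneg : u y s < b y := by
    have : 0 ≤ δ * s := by positivity
    linarith
  have hyΩ : (y, s) ∈ Ω := hL.covers y hy hLy s hs0
  have hs : 0 < s := by
    refine lt_of_le_of_ne hs0 fun he => ?_
    subst he
    linarith [hL.le_initial hy hyΩ, hblt y]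
  -- The minimiser avoids the edge of the superlevel set, since `L ≤ u < b < ψ` there; the minimum
  -- is therefore local.
  have hLlt : L < ψ y := by linarith [hf.le_height hβ hL hyΩ, hblt y]
  have hev : ∀ᶠ z in 𝓝 (y, s), z.2 ≤ s →
      u y s - b y + δ * s ≤ u z.1 z.2 - b z.1 + δ * z.2 := by
    have h1 : ∀ᶠ y' in 𝓝 y, y' ∈ P ∧ L < ψ y' :=
      (h.isOpen.eventually_mem hy).and ((h.contDiffAt hy).continuousAt.eventually (lt_mem_nhds hLlt))
    filter_upwards [continuousAt_fst.eventually h1, continuousAt_snd.eventually (lt_mem_nhds hs)]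
      with z h2 h3 h4
    exact hmin (show z ∈ _ from ⟨⟨h2.1, h2.2.le⟩, h3.le, h4.trans hst⟩)
  have hcontact := hf.contact_above hyΩ hs ((hbd y hy).of_le (by norm_cast)) hev
  obtain ⟨hs1, hs2⟩ := hsmall y hy hLy
  have h5 := (hdepth (ψ y)).2 y hy rfl ε hε hs1.le
  have h6 := penalisation_anti h hβ hε hy hneg.le (hblt y)
  have h7 : 0 ≤ Real.sqrt (1 + ‖gradient b y‖ ^ 2) *
      (-meanCurvature b y + penalisation β ε (obstacle P ψ) (point y (u y s))) := by
    refine mul_nonneg (Real.sqrt_nonneg _) ?_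
    simp only [hb] at h6 ⊢
    linarith
  linarith

theorem inner_graphNormal_vertical_inv (f : Base n → ℝ) (x : Base n) :
    (inner ℝ (graphNormal f x) (vertical n))⁻¹ = gradientFunction f x := rfl

theorem inner_graphNormal_vertical_pos (f : Base n → ℝ) (x : Base n) :
    0 < inner ℝ (graphNormal f x) (vertical n) := by
  rw [← inv_pos, inner_graphNormal_vertical_inv]
  exact zero_lt_one.trans_le (one_le_gradientFunction f x)

theorem IsObstacle.exists_bound (h : IsObstacle P ψ) (hβ : IsPenaltyProfile β) {d : ℝ → ℝ}
    (hd : ContDiff ℝ ∞ d) (ℓ : ℝ) : ∃ K, ∀ x ∈ P, ℓ ≤ ψ x → ∀ y ∈ P, ℓ ≤ ψ y →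
      β (-d (ψ x)) + gradientFunction ψ y ≤ K := by
  have h1 : ContinuousOn (fun x => β (-d (ψ x))) {x | x ∈ P ∧ ℓ ≤ ψ x} := fun x hx =>
    ((hβ.smooth.continuous.comp hd.continuous.neg).continuousAt.comp
      (h.contDiffAt hx.1).continuousAt).continuousWithinAt
  have h2 : ContinuousOn (gradientFunction ψ) {x | x ∈ P ∧ ℓ ≤ ψ x} := fun x hx => by
    have hg := (contDiffAt_gradient (h.contDiffAt hx.1)).continuousAt
    have : ContinuousAt (fun x => Real.sqrt (1 + ‖gradient ψ x‖ ^ 2)) x :=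
      Real.continuous_sqrt.continuousAt.comp (continuousAt_const.add (hg.norm.pow 2))
    simp only [← gradientFunction_eq] at this
    exact this.continuousWithinAt
  obtain ⟨K₁, hK₁⟩ := (h.isCompact_superlevel ℓ).bddAbove_image h1
  obtain ⟨K₂, hK₂⟩ := (h.isCompact_superlevel ℓ).bddAbove_image h2
  exact ⟨K₁ + K₂, fun x hx hx' y hy hy' =>
    add_le_add (hK₁ ⟨x, ⟨hx, hx'⟩, rfl⟩) (hK₂ ⟨y, ⟨hy, hy'⟩, rfl⟩)⟩

theorem IsPenalisedFlow.isObstacleBound (hf : IsPenalisedFlow P ψ β ε Ω u) (h : IsObstacle P ψ)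
    (hβ : IsPenaltyProfile β) (hε : 0 < ε) {L ℓ C K : ℝ} (hL : IsTruncatedAt P ψ L Ω u)
    {d : ℝ → ℝ} (hd : ContDiff ℝ ∞ d) (hdepth : ∀ y, d y ∈ barrierDepths P ψ β y) (hC0 : 0 < C)
    (hC : ∀ x ∈ P, L ≤ ψ x → ∀ y ∈ P, L ≤ ψ y →
      ‖graphNormal ψ x - graphNormal ψ y‖ ≤ C * ‖x - y‖)
    (hsmall : ∀ x ∈ {x | x ∈ P ∧ L ≤ ψ x}, ε * d (ψ x) < 1 ∧ ε * d (ψ x) * C < 1 ∧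
      meanCurvature (fun y => ψ y - ε * d (ψ y)) x < meanCurvature ψ x + 1)
    (hK : ∀ x ∈ P, ℓ ≤ ψ x → ∀ y ∈ P, ℓ ≤ ψ y →
      β (-d (ψ x)) + gradientFunction ψ y ≤ K) :
    IsObstacleBound P ψ β ε ℓ Ω u K := by
  rintro t ht p ⟨⟨hz, hu⟩, hO⟩ hℓ
  obtain ⟨hP, hlt⟩ := hO
  have hLp : L ≤ p.snd := by rw [hu]; exact hf.le_height hβ hL hz
  have hLx : L ≤ ψ p.fst := hLp.trans hlt.le
  have hbar := hf.barrier_le h hβ hε hL hd hdepth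
    (fun x hx hLx => ⟨(hsmall x ⟨hx, hLx⟩).1, (hsmall x ⟨hx, hLx⟩).2.2⟩) hP hLx ht
  rw [← hu] at hbar
  have hdist : Metric.infDist p (frontier (obstacle P ψ)) ≤ ε * d (ψ p.fst) := by
    have h1 := infDist_frontier_le_dist (p := p) (A := obstacle P ψ) ⟨hP, hlt⟩
      (point_notMem_obstacle (P := P) (le_refl (ψ p.fst)))
    have h2 := dist_point_point_same p.fst p.snd (ψ p.fst)
    rw [point_fst_snd, abs_sub_comm, abs_of_pos (by linarith)] at h2
    linarith
  have hclose : Metric.infDist p (frontier (obstacle P ψ)) * C < 1 :=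
    lt_of_le_of_lt (mul_le_mul_of_nonneg_right hdist hC0.le) (hsmall _ ⟨hP, hLx⟩).2.1
  -- Level `L` is needed for the Lipschitz constant of the normal, level `ℓ` for a bound on its
  -- slope that does not involve `L`.
  obtain ⟨y, hy, hmy, hder⟩ := h.hasFDerivAt_signedDistBdry (p := p) (m := max L ℓ) (C := C)
    ⟨hP, hlt⟩ (max_le hLp hℓ) (fun x hx hx' y hy hy' => hC x hx ((le_max_left _ _).trans hx') y hy
      ((le_max_left _ _).trans hy')) hclose
  have hgrad : gradient (signedDistBdry (obstacle P ψ)) p = graphNormal ψ y :=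
    gradient_eq_of_hasFDerivAt hder
  refine ⟨⟨_, hder⟩, ?_, ?_⟩
  · rw [hgrad]
    exact inner_graphNormal_vertical_pos ψ y
  · rw [hgrad, inner_graphNormal_vertical_inv]
    refine le_trans (add_le_add_left ?_ _)
      (hK p.fst hP (hℓ.trans hlt.le) y hy ((le_max_right _ _).trans hmy))
    unfold penalisation
    apply hβ.antitone_self
    rw [signedDistBdry_of_mem (show p ∈ obstacle P ψ from ⟨hP, hlt⟩), neg_div, neg_le_neg_iff, div_le_iff₀ hε]
    linarith

end Barrier

/-! ### Choice of the constants and conclusion. -/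

theorem proposition7p1 :
    ∃ C : ℝ → ℝ → ℝ,
      ∀ (n : ℕ) (P : Set (Base n)) (ψ : Base n → ℝ) (β : ℝ → ℝ),
        IsObstacle P ψ → IsPenaltyProfile β →
        ∃ ε₀ K₀ : ℝ → ℝ, (∀ L, 0 < ε₀ L) ∧
          ∀ (L ε ℓ : ℝ) (Ω : Set (Base n × ℝ)) (u : Base n → ℝ → ℝ),
            0 < ε → ε < ε₀ L →
            IsPenalisedFlow P ψ β ε Ω u →
            IsTruncatedAt P ψ L Ω u →
            IsCompactAbove ℓ Ω u →
            IsObstacleBound P ψ β ε ℓ Ω u (K₀ ℓ) ∧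
            ∀ K : ℝ, IsObstacleBound P ψ β ε ℓ Ω u K →
              ∀ t, 0 ≤ t → ∀ p ∈ surface Ω u t, ℓ ≤ p.snd →
                localisedGradient ℓ u t p ≤
                  sSup (localisedGradient ℓ u 0 '' {q ∈ surface Ω u 0 | ℓ ≤ q.snd}) +
                    C (sSup ((fun q : Ambient n => q.snd) '' surface Ω u 0) - ℓ) K := by
  -- The height factor is at most `s ^ 2`; the maximum is the bound on `v` at an interior maximum
  -- point.
  refine ⟨fun s K => s ^ 2 * max 1 (max K (s * K)), fun n P ψ β hψ hβ => ?_⟩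
  -- Fixed before `L`, `ε`, `ℓ` and the solution, which is what frees `K₀` of all but `ℓ`.
  obtain ⟨d, hd, hdepth⟩ := exists_depth_function hψ hβ
  choose C hC0 hC using hψ.exists_lipschitz_normal
  choose K₀ hK₀ using hψ.exists_bound hβ hd
  have hsmall : ∀ L, ∃ ε₀ > 0, ∀ ε, 0 < ε → ε < ε₀ → ∀ x ∈ {x | x ∈ P ∧ L ≤ ψ x},
      ε * d (ψ x) < 1 ∧ ε * d (ψ x) * C L < 1 ∧
        meanCurvature (fun y => ψ y - ε * d (ψ y)) x < meanCurvature ψ x + 1 := by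
    intro L
    obtain ⟨ε₀, hε₀, hball⟩ := Metric.eventually_nhds_iff.1 (eventually_small hψ hd L (C L))
    refine ⟨ε₀, hε₀, fun ε h0 hlt => hball ?_⟩
    rwa [Real.dist_eq, sub_zero, abs_of_pos h0]
  choose ε₀ hε₀ hsmall using hsmall
  refine ⟨ε₀, K₀, hε₀, fun L ε ℓ Ω u hε hlt hf hL hcomp => ⟨?_, ?_⟩⟩
  · exact hf.isObstacleBound hψ hβ hε hL hd hdepth (hC0 L) (hC L) (hsmall L ε hε hlt) (hK₀ ℓ)
  · rintro K hK t ht p ⟨hz, hp⟩ hℓ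
    rw [localisedGradient_eq, hp]
    rw [hp] at hℓ
    exact hf.gradient_estimate hψ hβ hε hL hcomp hK hz hℓ
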